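/- Let $(M,\pi)$ be a connected Poisson manifold (smooth, Hausdorff, second countable, of finite dimension), with the conventions $X_f=\pi^\sharp(df)$, $\{f,g\}=df(X_g)$. Let $\mathfrak g$ be a finite-dimensional abelian real Lie algebra and let $\rho\colon\mathfrak g\to C^\infty(M)$, $u\mapsto H_u$, be a complete weakly Hamiltonian action: $\rho$ is linear, the Hamiltonian vector fields $X_u:=X_{H_u}$ are complete and define an infinitesimal action of $\mathfrak g$ (i.e. they commute). Let $c_{u,v}=\{H_u,H_v\}-H_{[u,v]}$ be its cocycle. Let $F\to M$ be a smooth vector sub-bundle of $\mathfrak g\times M\to M$ over the leaf space, i.e. $F_x=F_y$ whenever $x,y$ lie in the same symplectic leaf, and suppose that $F$ is symplectic relative to $c$, i.e. $c(x)$ restricts to a nondegenerate form on $F_x$ for every $x\in M$. Let $\mathfrak b\colon F\to\mathbb R^{2d}$ be a framing over the leaf space, i.e. a smooth global trivialization (with linear isomorphisms $\mathfrak b_x\colon F_x\to\mathbb R^{2d}$) which is constant along the symplectic leaves, and suppose that $\mathfrak b$ is compatible with the fibrewise symplectic forms: there is a symplectic form $\omega$ on $\mathbb R^{2d}$ with $$c_{u,v}(x)=\omega(\mathfrak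 b_x(u),\mathfrak b_x(v))\qquad\text{for all }x\in M,\ u,v\in F_x .$$ Put $N=\{x\in M\mid H_u(x)=0\ \text{for all } u\in F_x\}$. Then: 1. $N$ is an embedded submanifold of $M$ of codimension $2d$, and it is a Poisson–Dirac submanifold of $(M,\pi)$: $TN\cap\pi^\sharp(TN^0)=0$, and the induced bivector field $\pi|_N$ on $N$, determined by $(\pi|_N)^\sharp(\alpha|_{TN})=\pi^\sharp(\alpha)$ for all covectors $\alpha\in T^*M|_N$ with $\pi^\sharp(\alpha)\in TN$, is smooth and Poisson. 2. There is a diffeomorphism $\Phi\colon M\to\mathbb R^{2d}\times N$ of the form $\Phi(y)=(\mathfrak b_y(v),\phi^1_v(y))$ with $v=v(y)\in F_y$, where $\phi^1_v$ is the time-one flow of $X_v$, and $\Phi$ is a Poisson isomorphism $$\Phi\colon(M,\pi)\to(\mathbb R^{2d}\times N,\ \omega^{-1}\oplus\pi|_N),$$ where $\omega^{-1}$ is the constant Poisson structure on $\mathbb R^{2d}$ whose Hamiltonian vector fields are given by $\omega(X_f,\cdot)=df$. In other words, $M$ splits as the product of a symplectic vector space and a Poisson–Dirac submanifold with its induced Poisson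 structure. -/

import Mathlib

open Set Topology Manifold ContDiff

section Poisson

variable {E H : Type*} [NormedAddCommGroup E] [NormedSpace ℝ E] [TopologicalSpace H]
  (I : ModelWithCorners ℝ E H) (M : Type*) [TopologicalSpace M] [ChartedSpace H M]

/-- A field of bivectors `π` on `M` (no regularity imposed yet), encoded by the skew-symmetric maps
`π^♯ : T*M → TM`, so that `π(α, β) = α (π^♯ β)`. -/
structure BivectorField where
  sharp : ∀ x : M, (TangentSpace I x →L[ℝ] ℝ) →ₗ[ℝ] TangentSpace I x
  skew : ∀ (x : M) (α β : TangentSpace I x →L[ℝ] ℝ), α (sharp x β) = -β (sharp x α)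

variable {I M}

namespace BivectorField

/-- The Hamiltonian vector field `X_f = π^♯(df)`. -/
noncomputable def hamiltonian (π : BivectorField I M) (f : M → ℝ) (x : M) : TangentSpace I x :=
  π.sharp x (mvfderiv I f x)

/-- The bracket `{f, g} = π(df, dg) = df (X_g)`. -/
noncomputable def bracket (π : BivectorField I M) (f g : M → ℝ) (x : M) : ℝ :=
  mvfderiv I f x (π.hamiltonian g x)

/-- A bivector field is smooth when `π^♯` sends differentials of smooth functions to smooth vector
fields. -/
def IsSmooth [IsManifold I ∞ M] (π : BivectorField I M) : Prop :=
  ∀ f : M → ℝ, ContMDiff I 𝓘(ℝ, ℝ) ∞ f →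
    ContMDiff I I.tangent ∞ (fun x => (⟨x, π.hamiltonian f x⟩ : TangentBundle I M))

/-- A Poisson structure: a smooth bivector field whose bracket satisfies the Jacobi identity. -/
structure IsPoisson [IsManifold I ∞ M] (π : BivectorField I M) : Prop where
  smooth : π.IsSmooth
  jacobi : ∀ f g h : M → ℝ, ContMDiff I 𝓘(ℝ, ℝ) ∞ f → ContMDiff I 𝓘(ℝ, ℝ) ∞ g →
    ContMDiff I 𝓘(ℝ, ℝ) ∞ h → ∀ x,
      π.bracket f (π.bracket g h) x + π.bracket g (π.bracket h f) x
        + π.bracket h (π.bracket f g) x = 0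

/-- Two points lie in the same symplectic leaf when they can be joined by finitely many arcs of
integral curves of Hamiltonian vector fields. -/
def SameLeaf (π : BivectorField I M) : M → M → Prop :=
  Relation.EqvGen fun x y => ∃ f : M → ℝ, ContMDiff I 𝓘(ℝ, ℝ) ∞ f ∧ ∃ γ : ℝ → M,
    IsMIntegralCurveOn γ (π.hamiltonian f) (Icc 0 1) ∧ γ 0 = x ∧ γ 1 = y

end BivectorField

/-- A weakly Hamiltonian action of a Lie algebra `𝔤` on `(M, π)`, given by a linear lift
`u ↦ H_u` to smooth functions: the Hamiltonian vector fields `X_u = X_{H_u}` define an infinitesimal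
action of `𝔤`. With the convention `X_f = {·, f}` one has `[X_f, X_g] = -X_{{f, g}}`, so the action
condition reads `[X_u, X_v] = -X_{[u, v]}`. -/
structure WeaklyHamiltonianAction (π : BivectorField I M) (𝔤 : Type*) [LieRing 𝔤]
    [LieAlgebra ℝ 𝔤] where
  ham : 𝔤 →ₗ[ℝ] C^∞⟮I, M; 𝓘(ℝ, ℝ), ℝ⟯
  lie_eq : ∀ (u v : 𝔤) (x : M),
    VectorField.mlieBracket I (π.hamiltonian (ham u)) (π.hamiltonian (ham v)) x
      = -π.hamiltonian (ham ⁅u, v⁆) x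

section Action

variable {π : BivectorField I M} {𝔤 : Type*} [LieRing 𝔤] [LieAlgebra ℝ 𝔤]

namespace WeaklyHamiltonianAction

variable (ρ : WeaklyHamiltonianAction π 𝔤)

/-- The fundamental vector field `X_u`. -/
noncomputable def field (u : 𝔤) (x : M) : TangentSpace I x :=
  π.hamiltonian (ρ.ham u) x

/-- All fundamental vector fields are complete. -/
def IsComplete : Prop :=
  ∀ (u : 𝔤) (x : M), ∃ γ : ℝ → M, γ 0 = x ∧ IsMIntegralCurve γ (ρ.field u)

/-- The time-one flow of `X_u` sends `x` to `y`, i.e. `y = φ¹_u(x)`. -/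
def FlowsTo (u : 𝔤) (x y : M) : Prop :=
  ∃ γ : ℝ → M, IsMIntegralCurve γ (ρ.field u) ∧ γ 0 = x ∧ γ 1 = y

/-- The cocycle `c(u, v) = {H_u, H_v} - H_{[u, v]}`. -/
noncomputable def cocycle (u v : 𝔤) (x : M) : ℝ :=
  π.bracket (ρ.ham u) (ρ.ham v) x - ρ.ham ⁅u, v⁆ x

end WeaklyHamiltonianAction

variable (π 𝔤) in
/-- A smooth vector sub-bundle of the trivial bundle `𝔤 × M → M` over the leaf space: its fibres
agree at points of the same symplectic leaf. Smoothness of a `𝔤`-valued map, `𝔤` of finite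
dimension, is tested on linear functionals. -/
structure LeafSubbundle where
  fiber : M → Submodule ℝ 𝔤
  exists_local_frame : ∀ x₀ : M, ∃ U ∈ 𝓝 x₀, ∃ (k : ℕ) (s : Fin k → M → 𝔤),
    (∀ (i : Fin k) (ℓ : Module.Dual ℝ 𝔤), ContMDiffOn I 𝓘(ℝ, ℝ) ∞ (fun x => ℓ (s i x)) U) ∧
    ∀ x ∈ U, LinearIndependent ℝ (fun i => s i x) ∧
      Submodule.span ℝ (range fun i => s i x) = fiber x
  fiber_eq : ∀ x y : M, π.SameLeaf x y → fiber x = fiber y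

namespace LeafSubbundle

/-- `F` is symplectic relative to the cocycle of `ρ`: at every point `x` the (skew) form `c(x)` is
nondegenerate on the fibre `F_x`. -/
def IsSymplectic (F : LeafSubbundle π 𝔤) (ρ : WeaklyHamiltonianAction π 𝔤) : Prop :=
  ∀ (x : M), ∀ u ∈ F.fiber x, (∀ v ∈ F.fiber x, ρ.cocycle u v x = 0) → u = 0

/-- A framing over the leaf space: a smooth global trivialization `F → ℝˡ` (smoothness expressed
through the global frame of sections `x ↦ 𝔟ₓ⁻¹(a)`), constant along the symplectic leaves. -/
structure Framing (F : LeafSubbundle π 𝔤) (l : ℕ) where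
  triv : ∀ x : M, F.fiber x ≃ₗ[ℝ] EuclideanSpace ℝ (Fin l)
  smooth : ∀ (a : EuclideanSpace ℝ (Fin l)) (ℓ : Module.Dual ℝ 𝔤),
    ContMDiff I 𝓘(ℝ, ℝ) ∞ (fun x => ℓ ((triv x).symm a : 𝔤))
  triv_eq : ∀ x y : M, π.SameLeaf x y → ∀ (u : 𝔤) (hx : u ∈ F.fiber x) (hy : u ∈ F.fiber y),
    triv x ⟨u, hx⟩ = triv y ⟨u, hy⟩

/-- The set `N` of the points `x` with `H_u(x) = 0` for all `u ∈ F_x`. -/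
def zeroLocus (F : LeafSubbundle π 𝔤) (ρ : WeaklyHamiltonianAction π 𝔤) : Set M :=
  {x | ∀ u ∈ F.fiber x, ρ.ham u x = 0}

end LeafSubbundle

end Action

end Poisson

/-- A linear symplectic form on a real vector space. -/
structure LinearSymplecticForm (V : Type*) [AddCommGroup V] [Module ℝ V] where
  form : LinearMap.BilinForm ℝ V
  alt : form.IsAlt
  nondegenerate : form.Nondegenerate

section Linear

variable {V : Type*} [NormedAddCommGroup V] [NormedSpace ℝ V] [FiniteDimensional ℝ V]

/-- The linear map sending a covector `β` to the unique vector `w` with `Ω(w, ·) = β`. -/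
noncomputable def LinearSymplecticForm.sharp (Ω : LinearSymplecticForm V) :
    (V →L[ℝ] ℝ) →ₗ[ℝ] V :=
  (Ω.form.toDual Ω.nondegenerate).symm.toLinearMap ∘ₗ
    (ContinuousLinearMap.coeLM ℝ : (V →L[ℝ] ℝ) →ₗ[ℝ] (V →ₗ[ℝ] ℝ))

theorem LinearSymplecticForm.form_sharp (Ω : LinearSymplecticForm V) (β : V →L[ℝ] ℝ) (w : V) :
    Ω.form (Ω.sharp β) w = β w :=
  LinearMap.BilinForm.apply_toDual_symm_apply (hB := Ω.nondegenerate) (β : V →ₗ[ℝ] ℝ) w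

theorem LinearSymplecticForm.sharp_skew (Ω : LinearSymplecticForm V) (α β : V →L[ℝ] ℝ) :
    α (Ω.sharp β) = -β (Ω.sharp α) := by
  rw [← Ω.form_sharp α, ← Ω.form_sharp β]
  exact (Ω.alt.neg_eq _ _).symm

/-- The constant bivector field `Ω⁻¹` of a symplectic vector space: `X_f` is defined by
`Ω(X_f, ·) = df`, so that `{f, g} = Ω(X_f, X_g)`. -/
noncomputable def LinearSymplecticForm.inv (Ω : LinearSymplecticForm V) :
    BivectorField 𝓘(ℝ, V) V where
  sharp _ := Ω.sharp
  skew _ := Ω.sharp_skew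

end Linear

section Maps

variable {E E' H H' : Type*} [NormedAddCommGroup E] [NormedSpace ℝ E] [TopologicalSpace H]
  [NormedAddCommGroup E'] [NormedSpace ℝ E'] [TopologicalSpace H']
  {I : ModelWithCorners ℝ E H} {I' : ModelWithCorners ℝ E' H'}
  {M M' : Type*} [TopologicalSpace M] [ChartedSpace H M] [TopologicalSpace M'] [ChartedSpace H' M']

/-- The product bivector field `π ⊕ π'` on `M × M'`. -/
noncomputable def BivectorField.prod (π : BivectorField I M) (π' : BivectorField I' M') :
    BivectorField (I.prod I') (M × M') where
  sharp p :=
    { toFun := fun β =>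
        ((π.sharp p.1 ((show E × E' →L[ℝ] ℝ from β).comp (ContinuousLinearMap.inl ℝ E E')),
          π'.sharp p.2 ((show E × E' →L[ℝ] ℝ from β).comp (ContinuousLinearMap.inr ℝ E E'))) :
          E × E')
      map_add' := fun β β' => Prod.ext
        ((π.sharp p.1).map_add
          ((show E × E' →L[ℝ] ℝ from β).comp (ContinuousLinearMap.inl ℝ E E'))
          ((show E × E' →L[ℝ] ℝ from β').comp (ContinuousLinearMap.inl ℝ E E')))
        ((π'.sharp p.2).map_add
          ((show E × E' →L[ℝ] ℝ from β).comp (ContinuousLinearMap.inr ℝ E E'))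
          ((show E × E' →L[ℝ] ℝ from β').comp (ContinuousLinearMap.inr ℝ E E')))
      map_smul' := fun r β => Prod.ext
        ((π.sharp p.1).map_smul r
          ((show E × E' →L[ℝ] ℝ from β).comp (ContinuousLinearMap.inl ℝ E E')))
        ((π'.sharp p.2).map_smul r
          ((show E × E' →L[ℝ] ℝ from β).comp (ContinuousLinearMap.inr ℝ E E'))) }
  skew p α β := by
    have h₁ := π.skew p.1 ((show E × E' →L[ℝ] ℝ from α).comp (ContinuousLinearMap.inl ℝ E E'))
      ((show E × E' →L[ℝ] ℝ from β).comp (ContinuousLinearMap.inl ℝ E E'))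
    have h₂ := π'.skew p.2 ((show E × E' →L[ℝ] ℝ from α).comp (ContinuousLinearMap.inr ℝ E E'))
      ((show E × E' →L[ℝ] ℝ from β).comp (ContinuousLinearMap.inr ℝ E E'))
    have split : ∀ (γ : E × E' →L[ℝ] ℝ) (a : E) (b : E'), γ (a, b) =
        γ.comp (ContinuousLinearMap.inl ℝ E E') a + γ.comp (ContinuousLinearMap.inr ℝ E E') b := by
      intro γ a b
      simp [← map_add]
    refine (split α _ _).trans ?_
    refine Eq.trans ?_ (congrArg Neg.neg (split β _ _)).symm
    refine (congrArg₂ (· + ·) h₁ h₂).trans ?_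
    exact (neg_add _ _).symm

/-- `Φ` pushes `π` forward to `π'`: `dΦ ∘ π^♯ ∘ dΦ* = π'^♯ ∘ Φ`. -/
def IsPoissonMap (π : BivectorField I M) (π' : BivectorField I' M') (Φ : M → M') : Prop :=
  ∀ (x : M) (β : TangentSpace I' (Φ x) →L[ℝ] ℝ),
    mfderiv I I' Φ x (π.sharp x (β.comp (mfderiv I I' Φ x))) = π'.sharp (Φ x) β

/-- The submanifold `ι : M → M'` is a Poisson-Dirac submanifold of `(M', π')` with induced bivector
field `πN`: one has `TM ∩ π'^♯(TM°) = 0`, `πN` is smooth, and `πN^♯(α|_{TM}) = π'^♯(α)` for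
every covector `α` of `M'` along `M` with `π'^♯(α) ∈ TM`. -/
structure IsPoissonDirac [IsManifold I ∞ M] (π' : BivectorField I' M') (ι : M → M') (πN : BivectorField I M) :
    Prop where
  transverse : ∀ (p : M) (α : TangentSpace I' (ι p) →L[ℝ] ℝ),
    (∀ w : TangentSpace I p, α (mfderiv I I' ι p w) = 0) →
    π'.sharp (ι p) α ∈ range (mfderiv I I' ι p) → π'.sharp (ι p) α = 0
  induced : ∀ (p : M) (α : TangentSpace I' (ι p) →L[ℝ] ℝ),
    π'.sharp (ι p) α ∈ range (mfderiv I I' ι p) →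
    mfderiv I I' ι p (πN.sharp p (α.comp (mfderiv I I' ι p))) = π'.sharp (ι p) α
  smooth : πN.IsSmooth

end Maps

/-!
The framing `𝔟` turns the action into a family of functions indexed by the symplectic vector space
`V = ℝ^{2d}`: for `a` in `V` put `μ_a(x) = H_u(x)` with `u = 𝔟ₓ⁻¹(a)`. The coefficients of
`x ↦ 𝔟ₓ⁻¹(a)` are constant along the leaves, hence Casimir functions, so that the Hamiltonian vector
field `Y_a` of `μ_a` is `X_u` at `x`, and `{μ_a, μ_b} = Ω(a, b)`
(`LeafSubbundle.Framing.isCanonicalFamily`). As `𝔟` is constant along integral curves, completeness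
of the action gives time-one flows `A(a, ·)` of the `Y_a` (`exists_isTimeOneFlow`).

By the Jacobi identity the `Y_a` commute. Therefore `A` is an action of the additive group `V`
(`IsTimeOneFlow.add`), and it is smooth (`IsTimeOneFlow.contMDiff`). Let `J : M → V` be the moment
map defined by `Ω(J, c) = μ_c`. The bracket relations give `dJ(Y_b) = -b`, so `J` is a submersion
and `J(A(a, y)) = J(y) - a`. The set `N` is `J⁻¹(0)`; slice charts make it an embedded submanifold
(`exists_isSliceChart`, `isSmoothEmbedding_ofSlice`), and `p(y) = A(J(y), y)` is a smooth retraction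
of `M` onto `N` which is constant along the orbits of `A`. The splitting is `y ↦ (J(y), p(y))`, with
inverse `(a, n) ↦ A(-a, n)`.

The brackets of functions pulled back by `p` commute with all `μ_b`, again by the Jacobi identity,
and are therefore themselves pulled back from `N` (`IsZeroSlice.bracket_comp_comp`). This defines
the Poisson structure of `N`, makes `p` a Poisson map, and identifies `π` with `Ω⁻¹ ⊕ π_N`, because
the functions pulled back by `p` commute with the `μ_b`.

Smoothness of `A` rests on a theorem on smooth dependence of the solutions of `z' = f(a, z)` on the
parameter and the initial value, for parameters near one at which `f` vanishes. It comes from the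
implicit function theorem in a space of continuous maps (`exists_local_flow_contDiffAt`). Since
`A(a, ·)` is an iterate of `A(a/k, ·)`, small parameters suffice.
-/

universe u

/-! ### Composition operators on spaces of continuous maps -/

namespace ContinuousMap

variable {K : Type*} [TopologicalSpace K] [CompactSpace K]
  {E F : Type*} [NormedAddCommGroup E] [NormedSpace ℝ E] [NormedAddCommGroup F] [NormedSpace ℝ F]

/-- The pointwise evaluation `(T, h) ↦ (t ↦ T t (h t))` as a continuous bilinear map. -/
noncomputable def applyCLM : C(K, E →L[ℝ] F) →L[ℝ] C(K, E) →L[ℝ] C(K, F) :=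
  LinearMap.mkContinuous₂
    (LinearMap.mk₂ ℝ (fun (T : C(K, E →L[ℝ] F)) (h : C(K, E)) =>
        (⟨fun t => T t (h t), T.continuous.clm_apply h.continuous⟩ : C(K, F)))
      (fun _ _ _ => by ext; simp) (fun _ _ _ => by ext; simp)
      (fun _ _ _ => by ext; simp) (fun _ _ _ => by ext; simp)) 1
    (fun T h => by
      rw [one_mul]
      refine (norm_le _ (by positivity)).2 fun t => ?_
      exact ((T t).le_opNorm _).trans
        (mul_le_mul (T.norm_coe_le_norm t) (h.norm_coe_le_norm t) (norm_nonneg _) (by positivity)))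

/-- The inclusion of the constants in `C(K, E)` as a continuous linear map. -/
noncomputable def constantCLM : E →L[ℝ] C(K, E) :=
  LinearMap.mkContinuous
    { toFun := fun x => const K x
      map_add' := fun _ _ => rfl
      map_smul' := fun _ _ => rfl } 1
    (fun x => by
      rw [one_mul]
      exact (norm_le _ (norm_nonneg _)).2 fun t => le_rfl)

@[simp] theorem constantCLM_apply (x : E) (t : K) : constantCLM (K := K) x t = x := rfl

/-- The first-order Taylor estimate for `f`, uniform along the compact image of `γ`: this follows
from the continuity of composition with `f'` in the compact-open topology. -/
theorem hasFDerivAt_comp_left {f : E → F} {f' : E → E →L[ℝ] F} (hf : ∀ x, HasFDerivAt f (f' x) x)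
    (hc : Continuous f) (hc' : Continuous f') (γ : C(K, E)) :
    HasFDerivAt (fun γ : C(K, E) => (⟨f, hc⟩ : C(E, F)).comp γ)
      (applyCLM ((⟨f', hc'⟩ : C(E, E →L[ℝ] F)).comp γ)) γ := by
  rw [hasFDerivAt_iff_isLittleO_nhds_zero, Asymptotics.isLittleO_iff]
  intro c hcpos
  have hcont : Continuous fun γ : C(K, E) => (⟨f', hc'⟩ : C(E, E →L[ℝ] F)).comp γ :=
    continuous_postcomp _
  obtain ⟨δ, hδ, hδ'⟩ :=
    (Metric.continuous_iff (α := C(K, E)) (β := C(K, E →L[ℝ] F))).1 hcont γ c hcpos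
  filter_upwards [Metric.ball_mem_nhds (0 : C(K, E)) hδ] with h hh
  rw [mem_ball_zero_iff] at hh
  refine (norm_le _ (by positivity)).2 fun t => ?_
  have key : ∀ z ∈ segment ℝ (γ t) (γ t + h t), ‖f' z - f' (γ t)‖ ≤ c := by
    intro z hz
    rw [segment_eq_image'] at hz
    obtain ⟨s, hs, rfl⟩ := hz
    have hd : dist (γ + s • h) γ < δ := by
      rw [dist_eq_norm, add_sub_cancel_left, norm_smul, Real.norm_eq_abs, abs_of_nonneg hs.1]
      exact (mul_le_of_le_one_left (norm_nonneg _) hs.2).trans_lt hh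
    have := (dist_apply_le_dist t).trans (hδ' _ hd).le
    rw [dist_eq_norm] at this
    simpa using this
  have := (convex_segment (γ t) (γ t + h t)).norm_image_sub_le_of_norm_hasFDerivWithin_le'
    (fun z _ => (hf z).hasFDerivWithinAt) key (left_mem_segment ℝ _ _) (right_mem_segment ℝ _ _)
  simp only [add_sub_cancel_left] at this
  refine this.trans ?_
  gcongr
  exact h.norm_coe_le_norm t

/-- The `C^n` version of `contDiff_comp_left`, by induction on `n`: the derivative of composition
with `f` is composition with `f'`, followed by a continuous bilinear map. -/
theorem contDiff_nat_comp_left {E : Type u} [NormedAddCommGroup E] [NormedSpace ℝ E] (n : ℕ) :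
    ∀ {F : Type u} [NormedAddCommGroup F] [NormedSpace ℝ F] {f : E → F} (hf : ContDiff ℝ n f),
      ContDiff ℝ n (fun γ : C(K, E) => (⟨f, hf.continuous⟩ : C(E, F)).comp γ) := by
  induction n with
  | zero =>
    intro F _ _ f hf
    exact contDiff_zero.2 (continuous_postcomp _)
  | succ n ih =>
    intro F _ _ f hf
    have h1 : ContDiff ℝ n (fderiv ℝ f) := (contDiff_succ_iff_fderiv.1 (by exact_mod_cast hf)).2.2
    have hd : ∀ γ : C(K, E), HasFDerivAt (fun γ : C(K, E) => (⟨f, hf.continuous⟩ : C(E, F)).comp γ)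
        (applyCLM ((⟨fderiv ℝ f, h1.continuous⟩ : C(E, E →L[ℝ] F)).comp γ)) γ :=
      hasFDerivAt_comp_left
        (fun x => (hf.differentiable (by simp) x).hasFDerivAt) hf.continuous h1.continuous
    have : ContDiff ℝ ((n : WithTop ℕ∞) + 1)
        (fun γ : C(K, E) => (⟨f, hf.continuous⟩ : C(E, F)).comp γ) := by
      rw [contDiff_succ_iff_hasFDerivAt]
      refine ⟨_, ?_, hd⟩
      exact ContDiff.comp (g := fun T => applyCLM (K := K) (E := E) (F := F) T)
        (ContinuousLinearMap.contDiff _) (ih h1)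
    exact_mod_cast this

/-- Composition with a smooth map `f` is a smooth map `C(K, E) → C(K, F)`. -/
theorem contDiff_comp_left {E F : Type u} [NormedAddCommGroup E] [NormedSpace ℝ E]
    [NormedAddCommGroup F] [NormedSpace ℝ F] {f : E → F} (hf : ContDiff ℝ ∞ f) :
    ContDiff ℝ ∞ (fun γ : C(K, E) => (⟨f, hf.continuous⟩ : C(E, F)).comp γ) :=
  contDiff_infty.2 fun n => contDiff_nat_comp_left n (hf.of_le (by exact_mod_cast le_top))

variable {a b : ℝ} (h : a ≤ b)

/-- The primitive `t ↦ ∫₀ᵗ g`, as a continuous linear operator on `C([a, b], E)`; the integrand is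
extended by constants outside `[a, b]`. -/
noncomputable def primitiveCLM [CompleteSpace E] : C(Icc a b, E) →L[ℝ] C(Icc a b, E) :=
  LinearMap.mkContinuous
    { toFun := fun g => ⟨fun t => ∫ s in (0 : ℝ)..t, IccExtend h g s,
        (intervalIntegral.continuous_primitive
          (fun _ _ => (g.continuous.Icc_extend' (h := h)).intervalIntegrable _ _) 0).comp
            continuous_subtype_val⟩
      map_add' := fun f g => by
        ext t
        exact intervalIntegral.integral_add
          ((f.continuous.Icc_extend' (h := h)).intervalIntegrable _ _)
          ((g.continuous.Icc_extend' (h := h)).intervalIntegrable _ _)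
      map_smul' := fun r g => by
        ext t
        exact intervalIntegral.integral_smul r (IccExtend h g) }
    (max |a| |b|) (fun g => by
      refine (norm_le _ (by positivity)).2 fun t => ?_
      refine (intervalIntegral.norm_integral_le_of_norm_le_const
        (C := ‖g‖) fun s _ => g.norm_coe_le_norm _).trans ?_
      rw [sub_zero, mul_comm]
      gcongr
      exact abs_le_max_abs_abs t.2.1 t.2.2)

theorem primitiveCLM_apply [CompleteSpace E] (g : C(Icc a b, E)) (t : Icc a b) :
    primitiveCLM h g t = ∫ s in (0 : ℝ)..t, IccExtend h g s := rfl

end ContinuousMap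

/-! ### Flows depending smoothly on a parameter -/

open ContinuousMap in
/-- Smooth dependence of the solutions of `z' = f(a, z)` on the parameter `a` and the initial
value, for small `a` when `f(0, ·) = 0`. The equation `z = x + ∫ f(a, z)` in the Banach space
`C([-2, 2], E)` is solved by the implicit function theorem; at `a = 0` its derivative with respect
to `z` is the identity. -/
theorem exists_local_flow_contDiffAt {P E : Type u} [NormedAddCommGroup P] [NormedSpace ℝ P]
    [CompleteSpace P] [NormedAddCommGroup E] [NormedSpace ℝ E] [CompleteSpace E]
    {f : P × E → E} (hf : ContDiff ℝ ∞ f) (hf0 : ∀ x, f (0, x) = 0) (x₀ : E) :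
    ∃ Z : P × E → ℝ → E, ContDiffAt ℝ ∞ (fun p => Z p 1) (0, x₀) ∧
      ∀ U ∈ 𝓝 x₀, ∀ᶠ p in 𝓝 ((0 : P), x₀), Z p 0 = p.2 ∧
        ∀ t ∈ Icc (-2 : ℝ) 2, Z p t ∈ U ∧ HasDerivAt (Z p) (f (p.1, Z p t)) t := by
  have h22 : (-2 : ℝ) ≤ 2 := by norm_num
  let pair : P × C(Icc (-2 : ℝ) 2, E) →L[ℝ] C(Icc (-2 : ℝ) 2, P × E) :=
    ((ContinuousLinearMap.inl ℝ P E).compLeftContinuous ℝ _).comp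
        (constantCLM.comp (ContinuousLinearMap.fst ℝ _ _)) +
      ((ContinuousLinearMap.inr ℝ P E).compLeftContinuous ℝ _).comp
        (ContinuousLinearMap.snd ℝ _ _)
  have hpair : ∀ q t, pair q t = (q.1, q.2 t) := fun q t => by
    simp [pair]
  let B : (P × E) × C(Icc (-2 : ℝ) 2, E) → C(Icc (-2 : ℝ) 2, E) := fun q =>
    primitiveCLM h22 ((⟨f, hf.continuous⟩ : C(P × E, E)).comp (pair (q.1.1, q.2)))
  -- the solutions are the zeros of `T`
  let T : (P × E) × C(Icc (-2 : ℝ) 2, E) → C(Icc (-2 : ℝ) 2, E) := fun q =>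
    q.2 - constantCLM q.1.2 - B q
  have hB : ContDiff ℝ ∞ B :=
    (primitiveCLM h22).contDiff.comp ((contDiff_comp_left hf).comp
      (pair.contDiff.comp ((contDiff_fst.comp contDiff_fst).prodMk contDiff_snd)))
  have hT : ContDiff ℝ ∞ T :=
    (contDiff_snd.sub ((constantCLM (K := Icc (-2 : ℝ) 2) (E := E)).contDiff.comp
      (contDiff_snd.comp contDiff_fst))).sub hB
  let u : (P × E) × C(Icc (-2 : ℝ) 2, E) := ((0, x₀), constantCLM x₀)
  have hB0 : ∀ x γ, B ((0, x), γ) = 0 := fun x γ => by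
    have : (⟨f, hf.continuous⟩ : C(P × E, E)).comp (pair (0, γ)) = 0 := by
      ext t
      simp [hpair, hf0]
    simp only [B, this, map_zero]
  have hinv : fderiv ℝ T u ∘L .inr ℝ (P × E) C(Icc (-2 : ℝ) 2, E) = ContinuousLinearMap.id ℝ _ := by
    have h1 : HasFDerivAt (fun γ : C(Icc (-2 : ℝ) 2, E) => T ((0, x₀), γ))
        (fderiv ℝ T u ∘L .inr ℝ (P × E) C(Icc (-2 : ℝ) 2, E)) (constantCLM x₀) := by
      have := (hT.differentiable (by simp) u).hasFDerivAt
      exact this.comp (constantCLM x₀) (hasFDerivAt_prodMk_right (0, x₀) (constantCLM x₀))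
    refine h1.unique ?_
    have h2 : (fun γ : C(Icc (-2 : ℝ) 2, E) => T ((0, x₀), γ)) = fun γ => γ - constantCLM x₀ := by
      ext1 γ
      simp only [T, hB0, sub_zero]
    rw [h2]
    exact (hasFDerivAt_id _).sub_const _
  have hI : (fderiv ℝ T u ∘L .inr ℝ (P × E) C(Icc (-2 : ℝ) 2, E)).IsInvertible := by
    rw [hinv]
    exact ⟨ContinuousLinearEquiv.refl ℝ _, rfl⟩
  have hTu : T u = 0 := by
    simp only [T, u, hB0, sub_self]
  have hTc : ContDiffAt ℝ ∞ T u := hT.contDiffAt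
  let ψ := hTc.implicitFunction (by simp) hI
  have hψc : ContDiffAt ℝ ∞ ψ (0, x₀) := hTc.contDiffAt_implicitFunction (by simp) hI
  have hψ0 : ψ (0, x₀) = constantCLM x₀ := hTc.implicitFunction_apply_self (by simp) hI
  have hψe : ∀ᶠ p in 𝓝 ((0 : P), x₀), T (p, ψ p) = 0 := by
    simpa [hTu] using! hTc.eventually_apply_implicitFunction (by simp) hI
  -- away from the solutions of `T = 0`, which are all that matters, `Z` has no meaning
  let Z : P × E → ℝ → E := fun p t => p.2 + ∫ s in (0 : ℝ)..t,
    Set.IccExtend h22 ((⟨f, hf.continuous⟩ : C(P × E, E)).comp (pair (p.1, ψ p))) s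
  have hZ : ∀ p, T (p, ψ p) = 0 → ∀ t : Icc (-2 : ℝ) 2, Z p t = ψ p t := by
    intro p hp t
    have := congrArg (fun g : C(Icc (-2 : ℝ) 2, E) => g t) hp
    simp only [T, B, coe_sub, Pi.sub_apply, constantCLM_apply, ContinuousMap.zero_apply,
      primitiveCLM_apply] at this
    rw [sub_sub, sub_eq_zero] at this
    exact this.symm
  refine ⟨Z, ?_, fun U hU => ?_⟩
  · have hev : (fun p => Z p 1) =ᶠ[𝓝 (0, x₀)] fun p => ψ p ⟨1, by norm_num⟩ :=
      hψe.mono fun p hp => hZ p hp ⟨1, by norm_num⟩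
    refine ContDiffAt.congr_of_eventuallyEq ?_ hev
    exact (ContinuousMap.evalCLM ℝ (⟨1, by norm_num⟩ : Icc (-2 : ℝ) 2)).contDiff.contDiffAt.comp
      (0, x₀) hψc
  · obtain ⟨ε, hε, hεU⟩ := Metric.mem_nhds_iff.1 hU
    have hnear : ∀ᶠ p in 𝓝 ((0 : P), x₀), dist (ψ p) (ψ (0, x₀)) < ε :=
      Metric.tendsto_nhds.1 hψc.continuousAt ε hε
    filter_upwards [hψe, hnear] with p hp hn
    refine ⟨by simp [Z], fun t ht => ⟨hεU ?_, ?_⟩⟩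
    · rw [hZ p hp ⟨t, ht⟩, Metric.mem_ball]
      have := (dist_apply_le_dist (f := ψ p) (g := ψ (0, x₀)) ⟨t, ht⟩).trans_lt hn
      rwa [hψ0] at this
    · have hcont : Continuous (Set.IccExtend h22
          ((⟨f, hf.continuous⟩ : C(P × E, E)).comp (pair (p.1, ψ p)))) :=
        (ContinuousMap.continuous _).Icc_extend'
      have hd := (hcont.integral_hasStrictDerivAt 0 t).hasDerivAt.const_add p.2
      have he : Set.IccExtend h22 ((⟨f, hf.continuous⟩ : C(P × E, E)).comp (pair (p.1, ψ p))) t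
          = f (p.1, Z p t) := by
        rw [Set.IccExtend_of_mem h22 _ ht, hZ p hp ⟨t, ht⟩]
        simp [hpair]
      rw [he] at hd
      exact hd

/-! ### Smoothness of the time-one flow of a linear family of vector fields -/

section Flow

variable {E : Type u} [NormedAddCommGroup E] [NormedSpace ℝ E]
  {H : Type*} [TopologicalSpace H] {I : ModelWithCorners ℝ E H}
  {M : Type*} [TopologicalSpace M] [ChartedSpace H M]

/-- The derivative of a smooth function along a smooth vector field is smooth. -/
theorem ContMDiff.mvfderiv_section [IsManifold I ∞ M] {F : Type*} [NormedAddCommGroup F]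
    [NormedSpace ℝ F] {f : M → F}
    (hf : ContMDiff I 𝓘(ℝ, F) ∞ f) {v : (x : M) → TangentSpace I x}
    (hv : ContMDiff I I.tangent ∞ (fun x => (⟨x, v x⟩ : TangentBundle I M))) :
    ContMDiff I 𝓘(ℝ, F) ∞ (fun x => mvfderiv I f x (v x)) := by
  have h1 := (hf.contMDiff_tangentMap (m := ∞) (by simp)).comp hv
  exact contMDiff_snd_tangentBundle_modelSpace F 𝓘(ℝ, F) |>.comp h1

/-- The derivative of a function along a curve with prescribed velocity. -/
theorem HasMFDerivAt.hasDerivAt_comp_curve {F : Type*} [NormedAddCommGroup F] [NormedSpace ℝ F]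
    {f : M → F} {γ : ℝ → M} {t : ℝ} {v : TangentSpace I (γ t)}
    (hγ : HasMFDerivAt 𝓘(ℝ, ℝ) I γ t ((1 : ℝ →L[ℝ] ℝ).smulRight v))
    (hf : MDifferentiableAt I 𝓘(ℝ, F) f (γ t)) :
    HasDerivAt (fun s => f (γ s)) (mvfderiv I f (γ t) v) t := by
  have h := (hf.hasMFDerivAt.comp t hγ).hasFDerivAt
  rw [hasDerivAt_iff_hasFDerivAt]
  refine h.congr_fderiv ?_
  ext
  change mfderiv I 𝓘(ℝ, F) f (γ t) ((1 : ℝ) • v) = (1 : ℝ) • mvfderiv I f (γ t) v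
  rw [one_smul, one_smul]
  rfl

/-- A curve read in the chart at `y₀` has velocity `v` as soon as its coordinate expression has the
coordinate expression of `v` as its velocity. -/
theorem HasDerivAt.hasMFDerivAt_extChartAt_symm [IsManifold I ∞ M] [I.Boundaryless] {y₀ : M}
    {z : ℝ → E} {t : ℝ} {w : E} (hz : HasDerivAt z w t) (ht : z t ∈ (extChartAt I y₀).target)
    {v : TangentSpace I ((extChartAt I y₀).symm (z t))}
    (hv : w = mvfderiv I (extChartAt I y₀) ((extChartAt I y₀).symm (z t)) v) :
    HasMFDerivAt 𝓘(ℝ, ℝ) I ((extChartAt I y₀).symm ∘ z) t ((1 : ℝ →L[ℝ] ℝ).smulRight v) := by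
  have h1 : MDifferentiableAt 𝓘(ℝ, E) I (extChartAt I y₀).symm (z t) :=
    ((mdifferentiableOn_extChartAt_symm (I := I)) _ ht).mdifferentiableAt
      (extChartAt_target_mem_nhds' ht)
  have h2 : HasMFDerivAt 𝓘(ℝ, ℝ) 𝓘(ℝ, E) z t ((1 : ℝ →L[ℝ] ℝ).smulRight w) :=
    hz.hasFDerivAt.hasMFDerivAt
  refine (h1.hasMFDerivAt.comp t h2).congr_mfderiv ?_
  have h3 := congrArg (fun T => T v)
    (mfderivWithin_extChartAt_symm_comp_mfderiv_extChartAt (I := I) (x := y₀) ht)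
  simp only [I.range_eq_univ, mfderivWithin_univ] at h3
  ext
  change mfderiv 𝓘(ℝ, E) I (extChartAt I y₀).symm (z t) ((1 : ℝ) • w) = (1 : ℝ) • v
  rw [one_smul, one_smul, hv]
  exact h3

variable [IsManifold I ∞ M] [T2Space M] [I.Boundaryless]
  {V : Type u} [NormedAddCommGroup V] [NormedSpace ℝ V]
  {Y : V →ₗ[ℝ] ((x : M) → TangentSpace I x)} {A : V → M → M}

/-- `A a` is the time-one flow of the smooth vector field `Y a`, where `Y a` depends linearly on
`a`. The time-`t` flow of `Y a` is then `A (t • a)`, so no separate time variable is needed. -/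
structure IsTimeOneFlow (Y : V →ₗ[ℝ] ((x : M) → TangentSpace I x)) (A : V → M → M) : Prop where
  smooth : ∀ a, ContMDiff I I.tangent ∞ (fun x => (⟨x, Y a x⟩ : TangentBundle I M))
  zero : ∀ y, A 0 y = y
  curve : ∀ a y, IsMIntegralCurve (fun t : ℝ => A (t • a) y) (Y a)

namespace IsTimeOneFlow

/-- The time-one flow of a smooth family `a ↦ Y_a` of vector fields, linear in `a`, is smooth in
`(a, y)` at `a = 0`: in a chart around `y₀`, with the fields cut off outside of it, the flow is
given by an ordinary differential equation with parameter `a` whose right hand side vanishes at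
`a = 0`. -/
theorem contMDiffAt_zero [FiniteDimensional ℝ E] [FiniteDimensional ℝ V]
    (hA : IsTimeOneFlow Y A) (y₀ : M) :
    ContMDiffAt (𝓘(ℝ, V).prod I) I ∞ (fun q : V × M => A q.1 q.2) (0, y₀) := by
  let φ := extChartAt I y₀
  let x₀ := φ y₀
  let σ : SmoothBumpFunction I y₀ := Classical.arbitrary _
  let ξ : M → E := fun y => σ y • φ y
  have hξ : ContMDiff I 𝓘(ℝ, E) ∞ ξ := σ.contMDiff_smul contMDiffOn_extChartAt
  have hξφ : ξ =ᶠ[𝓝 y₀] φ := σ.eventuallyEq_one.mono fun y hy => by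
    simp only [ξ, hy, Pi.one_apply, one_smul]
  let G : V → M → E := fun a y => mvfderiv I ξ y (Y a y)
  have hG : ∀ a, ContMDiff I 𝓘(ℝ, E) ∞ (G a) := fun a => hξ.mvfderiv_section (hA.smooth a)
  have htarget : φ.target ∈ 𝓝 x₀ := extChartAt_target_mem_nhds y₀
  have hφs : ContMDiffOn 𝓘(ℝ, E) I ∞ φ.symm φ.target := contMDiffOn_extChartAt_symm y₀
  obtain ⟨r, hr, hrt⟩ := Metric.nhds_basis_closedBall.mem_iff.1 htarget
  let χ : ContDiffBump x₀ := ⟨r / 2, r, by positivity, by linarith⟩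
  have hχG : ∀ a, ContDiff ℝ ∞ (fun x => χ x • G a (φ.symm x)) := by
    intro a
    rw [contDiff_iff_contDiffAt]
    intro x
    by_cases hx : x ∈ φ.target
    · have h1 : ContMDiffAt 𝓘(ℝ, E) 𝓘(ℝ, E) ∞ (fun x => G a (φ.symm x)) x :=
        (hG a).contMDiffAt.comp x (hφs.contMDiffAt (extChartAt_target_mem_nhds' hx))
      exact χ.contDiff.contDiffAt.smul h1.contDiffAt
    · have hx' : x ∉ tsupport χ := fun h => hx (hrt (by rwa [χ.tsupport_eq] at h))
      refine contDiffAt_const (c := (0 : E)) |>.congr_of_eventuallyEq ?_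
      filter_upwards [(isClosed_tsupport χ).isOpen_compl.mem_nhds hx'] with z hz
      rw [image_eq_zero_of_notMem_tsupport hz, zero_smul]
  let b := Module.finBasis ℝ V
  let f : V × E → E := fun p => ∑ i, b.repr p.1 i • (χ p.2 • G (b i) (φ.symm p.2))
  have hf : ContDiff ℝ ∞ f := by
    refine ContDiff.sum fun i _ => ContDiff.smul ?_ ((hχG (b i)).comp contDiff_snd)
    exact (b.coord i).toContinuousLinearMap.contDiff.comp contDiff_fst
  have hfG : ∀ a x, f (a, x) = χ x • G a (φ.symm x) := by
    intro a x
    have : G a (φ.symm x) = ∑ i, b.repr a i • G (b i) (φ.symm x) := by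
      let ℓ : V →ₗ[ℝ] E := (mvfderiv I ξ (φ.symm x)).toLinearMap ∘ₗ
        LinearMap.proj (φ.symm x) ∘ₗ Y
      change ℓ a = ∑ i, b.repr a i • ℓ (b i)
      conv_lhs => rw [← b.sum_repr a]
      simp only [map_sum, map_smul]
    simp only [f, this, Finset.smul_sum]
    exact Finset.sum_congr rfl fun i _ => smul_comm _ _ _
  obtain ⟨Z, hZ, hZU⟩ := exists_local_flow_contDiffAt hf
    (fun x => by simp only [f, map_zero, Finsupp.coe_zero, Pi.zero_apply, zero_smul,
      Finset.sum_const_zero]) x₀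
  -- on `U` the cut-off functions are trivial and `f(a, ·)` is the coordinate expression of `Y_a`
  let U : Set E := {x | (x ∈ φ.target ∧ χ x = 1) ∧ ξ =ᶠ[𝓝 (φ.symm x)] φ}
  have hφc : ContinuousAt φ.symm x₀ := continuousAt_extChartAt_symm y₀
  have hU : U ∈ 𝓝 x₀ := by
    refine Filter.inter_mem (Filter.inter_mem htarget χ.eventuallyEq_one) ?_
    have h1 : ∀ᶠ y in 𝓝 (φ.symm x₀), ξ =ᶠ[𝓝 y] φ := by
      have : φ.symm x₀ = y₀ := extChartAt_to_inv y₀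
      rw [this]
      exact hξφ.eventuallyEq_nhds
    exact hφc.eventually h1
  have hZA : ∀ᶠ p in 𝓝 ((0 : V), x₀), A p.1 (φ.symm p.2) = φ.symm (Z p 1) := by
    filter_upwards [hZU U hU] with p hp
    have hcurve : IsMIntegralCurveOn (φ.symm ∘ Z p) (Y p.1) (Ioo (-2) 2) := by
      intro t ht
      obtain ⟨⟨⟨ht1, ht2⟩, ht3⟩, ht4⟩ := hp.2 t (Ioo_subset_Icc_self ht)
      refine (ht4.hasMFDerivAt_extChartAt_symm ht1 ?_).hasMFDerivWithinAt
      rw [hfG, ht2, one_smul]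
      simp only [G, mvfderiv]
      rw [ht3.mfderiv_eq]
      rfl
    have heq := isMIntegralCurveOn_Ioo_eqOn_of_contMDiff_boundaryless (t₀ := 0) (by norm_num)
      ((hA.smooth p.1).of_le (by simp))
      ((hA.curve p.1 (φ.symm p.2)).isMIntegralCurveOn (Ioo (-2) 2)) hcurve
      (by simp [hA.zero, hp.1])
    have := heq (show (1 : ℝ) ∈ Ioo (-2 : ℝ) 2 by norm_num)
    simpa using this
  have hcoord : ContMDiffAt (𝓘(ℝ, V).prod I) 𝓘(ℝ, V × E) ∞ (fun q : V × M => (q.1, φ q.2))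
      (0, y₀) :=
    contMDiffAt_fst.prodMk_space (contMDiffAt_extChartAt.comp (0, y₀) contMDiffAt_snd)
  have hev : (fun q : V × M => A q.1 q.2) =ᶠ[𝓝 (0, y₀)] fun q => φ.symm (Z (q.1, φ q.2) 1) := by
    have h1 := hcoord.continuousAt.eventually hZA
    have h2 : ∀ᶠ q : V × M in 𝓝 (0, y₀), q.2 ∈ φ.source :=
      continuousAt_snd.eventually (extChartAt_source_mem_nhds y₀)
    filter_upwards [h1, h2] with q hq1 hq2
    rw [← hq1, φ.left_inv hq2]
  refine ContMDiffAt.congr_of_eventuallyEq ?_ hev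
  have hZt : Z (0, x₀) 1 ∈ φ.target := by
    have := (hZU _ htarget).self_of_nhds
    exact (this.2 1 (by norm_num)).1
  exact ContMDiffAt.comp (0, y₀) (hφs.contMDiffAt (extChartAt_target_mem_nhds' hZt))
    (hZ.contMDiffAt.comp (0, y₀) hcoord)

protected theorem add_smul [CompleteSpace E] (hA : IsTimeOneFlow Y A)
    (s t : ℝ) (a : V) (y : M) : A ((s + t) • a) y = A (s • a) (A (t • a) y) := by
  have := isMIntegralCurve_Ioo_eq_of_contMDiff_boundaryless (t₀ := 0)
    ((hA.smooth a).of_le (by simp)) ((hA.curve a y).comp_add t) (hA.curve a (A (t • a) y))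
    (by simp [hA.zero])
  exact congrFun this s

/-- The time-one flow `A(a, y)` of a linear family of complete vector fields is smooth in `(a, y)`:
it is an iterate of `A(a / N, ·)`, where `a / N` is as close to `0` as needed along the compact
orbit segment `{A(t a, y) | 0 ≤ t ≤ 1}`. -/
protected theorem contMDiff [FiniteDimensional ℝ E] [FiniteDimensional ℝ V]
    (hA : IsTimeOneFlow Y A) :
    ContMDiff (𝓘(ℝ, V).prod I) I ∞ (fun q : V × M => A q.1 q.2) := by
  rw [contMDiff_infty]
  rintro n ⟨a₀, y₀⟩
  have hn : (n : ℕ∞ω) ≠ ∞ := by exact_mod_cast ENat.natCast_ne_top n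
  have : IsManifold I n M := IsManifold.of_le (n := ∞) (by exact_mod_cast le_top)
  have hloc : ∀ z, ∀ᶠ q : V × M in 𝓝 (0, z),
      ContMDiffAt (𝓘(ℝ, V).prod I) I n (fun q : V × M => A q.1 q.2) (q.1, q.2) := fun z =>
    (contMDiffAt_iff_contMDiffAt_nhds hn).1
      ((hA.contMDiffAt_zero z).of_le (by exact_mod_cast le_top))
  have hK : IsCompact ((fun t : ℝ => A (t • a₀) y₀) '' Icc 0 1) :=
    isCompact_Icc.image (hA.curve a₀ y₀).continuous
  have hsmall := hK.eventually_forall_of_forall_eventually (x₀ := (0 : V))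
    (P := fun a z => ContMDiffAt (𝓘(ℝ, V).prod I) I n (fun q : V × M => A q.1 q.2) (a, z))
    fun z _ => hloc z
  have hlim : Filter.Tendsto (fun N : ℕ => (1 / ((N : ℝ) + 1)) • a₀) Filter.atTop (𝓝 0) := by
    simpa using (tendsto_one_div_add_atTop_nhds_zero_nat (𝕜 := ℝ)).smul_const a₀
  obtain ⟨N, hN⟩ := (hlim.eventually hsmall).exists
  have hNpos : (0 : ℝ) < N + 1 := by positivity
  have key : ∀ k : ℕ, k ≤ N + 1 → ContMDiffAt (𝓘(ℝ, V).prod I) I n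
      (fun q : V × M => A (((k : ℝ) / (N + 1)) • q.1) q.2) (a₀, y₀) := by
    intro k
    induction k with
    | zero =>
      intro _
      simpa [hA.zero] using! contMDiffAt_snd
    | succ k ih =>
      intro hk
      have hstep : (fun q : V × M => A ((((k + 1 : ℕ) : ℝ) / (N + 1)) • q.1) q.2) = fun q =>
          A ((1 / ((N : ℝ) + 1)) • q.1) (A (((k : ℝ) / (N + 1)) • q.1) q.2) := by
        funext q
        rw [← hA.add_smul]
        congr 2
        push_cast
        ring
      rw [hstep]
      have hmem : A (((k : ℝ) / (N + 1)) • a₀) y₀ ∈ (fun t : ℝ => A (t • a₀) y₀) '' Icc 0 1 := by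
        refine ⟨(k : ℝ) / (N + 1), ⟨by positivity, ?_⟩, rfl⟩
        rw [div_le_one hNpos]
        exact_mod_cast (Nat.le_succ k).trans hk
      have hsc : ContMDiffAt (𝓘(ℝ, V).prod I) 𝓘(ℝ, V) n
          (fun q : V × M => (1 / ((N : ℝ) + 1)) • q.1) (a₀, y₀) :=
        (contDiff_id.const_smul (1 / ((N : ℝ) + 1))).contMDiff.contMDiffAt.comp (a₀, y₀)
          contMDiffAt_fst
      exact ContMDiffAt.comp (a₀, y₀) (g := fun q : V × M => A q.1 q.2)
        (f := fun q : V × M => ((1 / ((N : ℝ) + 1)) • q.1, A (((k : ℝ) / (N + 1)) • q.1) q.2))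
        (hN _ hmem) (hsc.prodMk (ih ((Nat.le_succ k).trans hk)))
  have := key (N + 1) le_rfl
  have hone : (((N + 1 : ℕ) : ℝ) / (N + 1)) = 1 := by
    push_cast
    exact div_self hNpos.ne'
  simpa only [hone, one_smul] using! this

end IsTimeOneFlow

end Flow

/-! ### Test functions and commuting flows -/

section TestFunctions

variable {E : Type*} [NormedAddCommGroup E] [NormedSpace ℝ E] [FiniteDimensional ℝ E]
  {H : Type*} [TopologicalSpace H] {I : ModelWithCorners ℝ E H}
  {M : Type*} [TopologicalSpace M] [ChartedSpace H M] [IsManifold I ∞ M] [T2Space M]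

omit [FiniteDimensional ℝ E] [IsManifold I ∞ M] [T2Space M] in
theorem mvfderiv_clm_comp_apply {F G : Type*} [NormedAddCommGroup F] [NormedSpace ℝ F]
    [NormedAddCommGroup G] [NormedSpace ℝ G] (ℓ : F →L[ℝ] G) {f : M → F} {x : M}
    (hf : MDifferentiableAt I 𝓘(ℝ, F) f x) (v : TangentSpace I x) :
    mvfderiv I (fun y => ℓ (f y)) x v = ℓ (mvfderiv I f x v) := by
  have h1 : mfderiv I 𝓘(ℝ, G) (ℓ ∘ f) x v = mfderiv 𝓘(ℝ, F) 𝓘(ℝ, G) ℓ (f x)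
      (mfderiv I 𝓘(ℝ, F) f x v) :=
    mfderiv_comp_apply x ((ℓ.contMDiff (n := ∞)).mdifferentiableAt (by simp)) hf v
  rw [mfderiv_eq_fderiv, ℓ.fderiv] at h1
  exact h1

/-- Every covector is the differential of a global smooth function. -/
theorem exists_contMDiff_mvfderiv_eq (x : M) (α : TangentSpace I x →L[ℝ] ℝ) :
    ∃ f : M → ℝ, ContMDiff I 𝓘(ℝ, ℝ) ∞ f ∧ mvfderiv I f x = α := by
  let σ : SmoothBumpFunction I x := Classical.arbitrary _
  let ξ : M → E := fun y => σ y • extChartAt I x y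
  have hξ : ContMDiff I 𝓘(ℝ, E) ∞ ξ := σ.contMDiff_smul contMDiffOn_extChartAt
  have hξφ : ξ =ᶠ[𝓝 x] extChartAt I x := σ.eventuallyEq_one.mono fun y hy => by
    simp only [ξ, hy, Pi.one_apply, one_smul]
  let α' : E →L[ℝ] ℝ := α
  refine ⟨fun y => α' (ξ y), α'.contMDiff.comp hξ, ?_⟩
  ext v
  rw [mvfderiv_clm_comp_apply α' (hξ.mdifferentiableAt (by simp)), mvfderiv, hξφ.mfderiv_eq,
    mfderiv_extChartAt_self]
  rfl

/-- Tangent vectors are separated by the differentials of global smooth functions. -/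
theorem tangent_eq_of_forall_mvfderiv {x : M} {v w : TangentSpace I x}
    (h : ∀ f : M → ℝ, ContMDiff I 𝓘(ℝ, ℝ) ∞ f → mvfderiv I f x v = mvfderiv I f x w) : v = w := by
  refine (SeparatingDual.eq_iff_forall_dual_eq (R := ℝ) (V := E)).2 fun α => ?_
  obtain ⟨f, hf, hfα⟩ := exists_contMDiff_mvfderiv_eq (I := I) x (α : TangentSpace I x →L[ℝ] ℝ)
  have := h f hf
  rwa [hfα] at this

/-- The velocity of a differentiable curve can be tested on smooth functions. -/
theorem hasMFDerivAt_of_forall_hasDerivAt_comp {γ : ℝ → M} {t : ℝ} {v : TangentSpace I (γ t)}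
    (hγ : MDifferentiableAt 𝓘(ℝ, ℝ) I γ t)
    (h : ∀ f : M → ℝ, ContMDiff I 𝓘(ℝ, ℝ) ∞ f →
      HasDerivAt (fun s => f (γ s)) (mvfderiv I f (γ t) v) t) :
    HasMFDerivAt 𝓘(ℝ, ℝ) I γ t ((1 : ℝ →L[ℝ] ℝ).smulRight v) := by
  let w : TangentSpace I (γ t) := mfderiv 𝓘(ℝ, ℝ) I γ t (1 : ℝ)
  have hw : mfderiv 𝓘(ℝ, ℝ) I γ t = (1 : ℝ →L[ℝ] ℝ).smulRight w := by
    ext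
    change w = (1 : ℝ) • w
    rw [one_smul]
  have h1 : HasMFDerivAt 𝓘(ℝ, ℝ) I γ t ((1 : ℝ →L[ℝ] ℝ).smulRight w) := by
    rw [← hw]
    exact hγ.hasMFDerivAt
  have : w = v := tangent_eq_of_forall_mvfderiv fun f hf =>
    (h1.hasDerivAt_comp_curve (hf.mdifferentiableAt (by simp))).unique (h f hf)
  rwa [this] at h1

end TestFunctions

/-- Differentiation along the diagonal of a mixed partial derivative; the order of differentiation
is exchanged in one of the two resulting terms. -/
theorem hasDerivAt_diagonal_partial {R : ℝ × ℝ × ℝ → ℝ} (hR : ContDiff ℝ 2 R)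
    {u w k : ℝ → ℝ} {c c' : ℝ} (hu : ∀ q, HasDerivAt (fun r => R (0, r, q)) (u q) 0)
    (huc : HasDerivAt u c 0) (hw : ∀ r, HasDerivAt (fun h => R (h, r, 0)) (w r) 0)
    (hwc : HasDerivAt w c' 0) (hk : ∀ h, HasDerivAt (fun r => R (h, r, h)) (k h) 0) :
    HasDerivAt k (c + c') 0 := by
  have hd : ∀ p, HasFDerivAt R (fderiv ℝ R p) p := fun p =>
    (hR.differentiable (by norm_num) p).hasFDerivAt
  have hd2 : HasFDerivAt (fderiv ℝ R) (fderiv ℝ (fderiv ℝ R) 0) 0 :=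
    ((hR.fderiv_right (m := 1) (by norm_num)).differentiable (by norm_num) 0).hasFDerivAt
  have hsymm : IsSymmSndFDerivAt ℝ R 0 := hR.contDiffAt.isSymmSndFDerivAt (by simp)
  -- a line in direction `e` through `p`
  have hline : ∀ (p e : ℝ × ℝ × ℝ), HasDerivAt (fun s : ℝ => p + s • e) e 0 := fun p e => by
    simpa using ((hasDerivAt_id (0 : ℝ)).smul_const e).const_add p
  have hpart : ∀ (p e : ℝ × ℝ × ℝ), HasDerivAt (fun s : ℝ => R (p + s • e)) (fderiv ℝ R p e) 0 :=
    fun p e => by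
      have h1 := hd (p + (0 : ℝ) • e)
      have h2 : HasDerivAt (fun s : ℝ => R (p + s • e)) (fderiv ℝ R (p + (0 : ℝ) • e) e) 0 :=
        h1.comp_hasDerivAt 0 (hline p e)
      rwa [zero_smul, add_zero] at h2
  have hpart2 : ∀ (e e' : ℝ × ℝ × ℝ), HasDerivAt (fun s : ℝ => fderiv ℝ R (s • e) e')
      (fderiv ℝ (fderiv ℝ R) 0 e e') 0 := fun e e' => by
    have h1 : HasFDerivAt (fderiv ℝ R) (fderiv ℝ (fderiv ℝ R) 0) (0 + (0 : ℝ) • e) := by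
      simpa using hd2
    have h2 := h1.comp_hasDerivAt 0 (hline 0 e)
    simpa using h2.clm_apply (hasDerivAt_const 0 e')
  let e₁ : ℝ × ℝ × ℝ := (1, 0, 0)
  let e₂ : ℝ × ℝ × ℝ := (0, 1, 0)
  let e₃ : ℝ × ℝ × ℝ := (0, 0, 1)
  have hu' : ∀ q, u q = fderiv ℝ R (q • e₃) e₂ := fun q =>
    (hu q).unique (by simpa [e₂, e₃] using hpart (q • e₃) e₂)
  have hw' : ∀ r, w r = fderiv ℝ R (r • e₂) e₁ := fun r =>
    (hw r).unique (by simpa [e₁, e₂] using hpart (r • e₂) e₁)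
  have hk' : ∀ h, k h = fderiv ℝ R (h • (e₁ + e₃)) e₂ := fun h =>
    (hk h).unique (by simpa [e₁, e₂, e₃] using hpart (h • (e₁ + e₃)) e₂)
  have hc : c = fderiv ℝ (fderiv ℝ R) 0 e₃ e₂ :=
    huc.unique (by rw [funext hu']; exact hpart2 e₃ e₂)
  have hc' : c' = fderiv ℝ (fderiv ℝ R) 0 e₁ e₂ := by
    rw [hsymm.eq e₁ e₂]
    exact hwc.unique (by rw [funext hw']; exact hpart2 e₂ e₁)
  rw [funext hk', hc, hc', add_comm, ← add_apply, ← map_add]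
  exact hpart2 _ _

section Commuting

variable {E : Type u} [NormedAddCommGroup E] [NormedSpace ℝ E] [FiniteDimensional ℝ E]
  {H : Type*} [TopologicalSpace H] {I : ModelWithCorners ℝ E H} [I.Boundaryless]
  {M : Type*} [TopologicalSpace M] [ChartedSpace H M] [IsManifold I ∞ M] [T2Space M]
  {V : Type u} [NormedAddCommGroup V] [NormedSpace ℝ V] [FiniteDimensional ℝ V]
  {Y : V →ₗ[ℝ] ((x : M) → TangentSpace I x)} {A : V → M → M}

namespace IsTimeOneFlow

theorem contMDiff_comp (hA : IsTimeOneFlow Y A) {E' H' X : Type*} [NormedAddCommGroup E']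
    [NormedSpace ℝ E'] [TopologicalSpace H'] {J : ModelWithCorners ℝ E' H'} [TopologicalSpace X]
    [ChartedSpace H' X] {τ : X → V} {y : X → M} (hτ : ContMDiff J 𝓘(ℝ, V) ∞ τ)
    (hy : ContMDiff J I ∞ y) : ContMDiff J I ∞ (fun x => A (τ x) (y x)) :=
  hA.contMDiff.comp (hτ.prodMk hy)

omit [FiniteDimensional ℝ E] [I.Boundaryless] [T2Space M] [FiniteDimensional ℝ V] in
theorem hasDerivAt_comp (hA : IsTimeOneFlow Y A) {f : M → ℝ} (hf : ContMDiff I 𝓘(ℝ, ℝ) ∞ f)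
    (a : V) (y : M) (t : ℝ) :
    HasDerivAt (fun s : ℝ => f (A (s • a) y)) (mvfderiv I f (A (t • a) y) (Y a (A (t • a) y))) t :=
  (hA.curve a y t).hasDerivAt_comp_curve (hf.mdifferentiableAt (by simp))

omit [FiniteDimensional ℝ E] [I.Boundaryless] [T2Space M] [FiniteDimensional ℝ V] in
theorem hasDerivAt_comp_zero (hA : IsTimeOneFlow Y A) {f : M → ℝ}
    (hf : ContMDiff I 𝓘(ℝ, ℝ) ∞ f) (a : V) (y : M) :
    HasDerivAt (fun s : ℝ => f (A (s • a) y)) (mvfderiv I f y (Y a y)) 0 := by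
  have := hA.hasDerivAt_comp hf a y 0
  rwa [zero_smul, hA.zero] at this

/-- The vector fields of the family commute, as derivations of the smooth functions. -/
def Commutes (Y : V →ₗ[ℝ] ((x : M) → TangentSpace I x)) : Prop :=
  ∀ (a b : V) (f : M → ℝ), ContMDiff I 𝓘(ℝ, ℝ) ∞ f → ∀ x,
    mvfderiv I (fun y => mvfderiv I f y (Y b y)) x (Y a x) =
      mvfderiv I (fun y => mvfderiv I f y (Y a y)) x (Y b x)

/-- The flow of `Y_a` preserves `Y_b`, infinitesimal form: the derivative of the pull-back of `Y_b`
at time zero is the commutator, which vanishes. -/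
theorem hasDerivAt_conj_zero (hA : IsTimeOneFlow Y A) (hY : Commutes Y) {f : M → ℝ}
    (hf : ContMDiff I 𝓘(ℝ, ℝ) ∞ f) (a b : V) (y : M) {k : ℝ → ℝ}
    (hk : ∀ h : ℝ, HasDerivAt (fun r : ℝ => f (A (h • -a) (A (r • b) (A (h • a) y)))) (k h) 0) :
    HasDerivAt k 0 0 := by
  -- the two occurrences of the time `h` are first treated as independent variables
  let R : ℝ × ℝ × ℝ → ℝ := fun p => f (A (p.1 • -a) (A (p.2.1 • b) (A (p.2.2 • a) y)))
  have hR : ContDiff ℝ ∞ R := by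
    refine ContMDiff.contDiff (hf.comp ?_)
    refine hA.contMDiff_comp (contDiff_fst.smul contDiff_const).contMDiff ?_
    refine hA.contMDiff_comp
      ((contDiff_fst.comp contDiff_snd).smul contDiff_const).contMDiff ?_
    exact hA.contMDiff_comp
      ((contDiff_snd.comp contDiff_snd).smul contDiff_const).contMDiff contMDiff_const
  have hfa := hf.mvfderiv_section (hA.smooth (-a))
  have hfb := hf.mvfderiv_section (hA.smooth b)
  have key := hasDerivAt_diagonal_partial (by exact_mod_cast contDiff_infty.1 hR 2)
    (u := fun q => mvfderiv I f (A (q • a) y) (Y b (A (q • a) y)))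
    (w := fun r => mvfderiv I f (A (r • b) y) (Y (-a) (A (r • b) y)))
    (fun q => by simpa [R, hA.zero] using hA.hasDerivAt_comp_zero hf b (A (q • a) y))
    (hA.hasDerivAt_comp_zero hfb a y)
    (fun r => by simpa [R, hA.zero] using hA.hasDerivAt_comp_zero hf (-a) (A (r • b) y))
    (hA.hasDerivAt_comp_zero hfa b y) hk
  have hneg : (fun z => mvfderiv I f z (Y (-a) z)) = -fun z => mvfderiv I f z (Y a z) := by
    funext z
    simp
  rw [hneg, mvfderiv_neg] at key
  convert key using 1
  rw [neg_apply, hY a b f hf y, add_neg_cancel]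

omit [FiniteDimensional ℝ V] in
theorem neg_smul_comp (hA : IsTimeOneFlow Y A) (t : ℝ) (a : V) (y : M) :
    A (t • -a) (A (t • a) y) = y := by
  rw [smul_neg, ← neg_smul, ← hA.add_smul, neg_add_cancel, zero_smul, hA.zero]

/-- The flow of `Y_a` preserves `Y_b`. -/
theorem hasDerivAt_conj (hA : IsTimeOneFlow Y A) (hY : Commutes Y) {f : M → ℝ}
    (hf : ContMDiff I 𝓘(ℝ, ℝ) ∞ f) (a b : V) (y : M) (t : ℝ) :
    HasDerivAt (fun r : ℝ => f (A (t • -a) (A (r • b) (A (t • a) y))))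
      (mvfderiv I f y (Y b y)) 0 := by
  have hFs : ∀ s : ℝ, ContMDiff I 𝓘(ℝ, ℝ) ∞ (fun z => f (A (s • -a) z)) := fun s =>
    hf.comp (hA.contMDiff_comp contMDiff_const contMDiff_id)
  -- `D t` is `f` differentiated along the pull-back of `Y_b` by the time-`t` flow of `Y_a`
  let D : ℝ → ℝ := fun t => mvfderiv I (fun z => f (A (t • -a) z)) (A (t • a) y) (Y b (A (t • a) y))
  have hD : ∀ t, HasDerivAt (fun r : ℝ => f (A (t • -a) (A (r • b) (A (t • a) y)))) (D t) 0 :=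
    fun t => hA.hasDerivAt_comp_zero (hFs t) b (A (t • a) y)
  have hD' : ∀ t, HasDerivAt D 0 t := by
    intro t
    have h1 : HasDerivAt (fun h => D (t + h)) 0 0 := by
      refine hA.hasDerivAt_conj_zero hY (hFs t) a b (A (t • a) y) fun h => ?_
      have h2 := hD (t + h)
      have h3 : ∀ z, A ((t + h) • -a) z = A (t • -a) (A (h • -a) z) := hA.add_smul t h (-a)
      have h4 : A ((t + h) • a) y = A (h • a) (A (t • a) y) := by
        rw [add_comm, hA.add_smul]
      simpa only [h3, h4] using h2
    have h5 := HasDerivAt.comp_sub_const (f := fun h => D (t + h)) t t (by simpa using h1)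
    simpa using h5
  have hconst : D t = D 0 := is_const_of_deriv_eq_zero (fun s => (hD' s).differentiableAt)
    (fun s => (hD' s).deriv) t 0
  have h0 : D 0 = mvfderiv I f y (Y b y) :=
    (hD 0).unique (by simpa [hA.zero] using hA.hasDerivAt_comp_zero hf b y)
  rw [← h0, ← hconst]
  exact hD t

/-- Commuting vector fields have commuting flows. -/
theorem comm (hA : IsTimeOneFlow Y A) (hY : Commutes Y) (a b : V) (y : M) :
    A a (A b y) = A b (A a y) := by
  -- the image of an integral curve of `Y_b` under the flow of `-Y_a` is an integral curve of `Y_b`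
  let c : ℝ → M := fun r => A ((1 : ℝ) • -a) (A (r • b) (A ((1 : ℝ) • a) y))
  have hc : ContMDiff 𝓘(ℝ, ℝ) I ∞ c := hA.contMDiff_comp contMDiff_const
    (hA.contMDiff_comp (contDiff_id.smul contDiff_const).contMDiff contMDiff_const)
  have hcurve : IsMIntegralCurve c (Y b) := by
    intro r
    refine hasMFDerivAt_of_forall_hasDerivAt_comp (hc.mdifferentiableAt (by simp)) fun f hf => ?_
    have h1 := hA.hasDerivAt_conj hY hf a b (c r) 1
    have h2 : ∀ s : ℝ, c (r + s) =
        A ((1 : ℝ) • -a) (A (s • b) (A ((1 : ℝ) • a) (c r))) := by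
      intro s
      have h3 : A ((1 : ℝ) • a) (c r) = A (r • b) (A ((1 : ℝ) • a) y) := by
        have := hA.neg_smul_comp 1 (-a) (A (r • b) (A ((1 : ℝ) • a) y))
        rwa [neg_neg] at this
      rw [h3, ← hA.add_smul, add_comm s r]
    simp only [← h2] at h1
    have h5 := HasDerivAt.comp_sub_const (f := fun s => f (c (r + s))) r r (by simpa using h1)
    simpa using h5
  have h0 := isMIntegralCurve_Ioo_eq_of_contMDiff_boundaryless (t₀ := 0)
    ((hA.smooth b).of_le (by simp)) hcurve (hA.curve b y)
    (by simp only [c, zero_smul, hA.zero]; exact hA.neg_smul_comp 1 a y)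
  have h1 : A (-a) (A b (A a y)) = A b y := by simpa [c] using congrFun h0 1
  rw [← h1]
  have := hA.neg_smul_comp 1 (-a) (A b (A a y))
  rwa [one_smul, neg_neg, one_smul] at this

/-- The time-one flows of a commuting linear family form an action of the additive group. -/
protected theorem add (hA : IsTimeOneFlow Y A) (hY : Commutes Y) (a b : V) (y : M) :
    A (a + b) y = A a (A b y) := by
  -- an integral curve of `Y_{a + b}`, hence equal to `t ↦ A(t(a + b), y)`
  let c : ℝ → M := fun t => A (t • a) (A (t • b) y)
  have hS : ContMDiff 𝓘(ℝ, ℝ × ℝ) I ∞ (fun p : ℝ × ℝ => A (p.1 • a) (A (p.2 • b) y)) :=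
    hA.contMDiff_comp (contDiff_fst.smul contDiff_const).contMDiff
      (hA.contMDiff_comp (contDiff_snd.smul contDiff_const).contMDiff contMDiff_const)
  have hc : ContMDiff 𝓘(ℝ, ℝ) I ∞ c := hS.comp (contDiff_id.prodMk contDiff_id).contMDiff
  have hcurve : IsMIntegralCurve c (Y (a + b)) := by
    intro t
    refine hasMFDerivAt_of_forall_hasDerivAt_comp (hc.mdifferentiableAt (by simp)) fun f hf => ?_
    let S : ℝ × ℝ → ℝ := fun p => f (A (p.1 • a) (A (p.2 • b) y))
    have hfS : HasFDerivAt S (fderiv ℝ S (t, t)) (t, t) :=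
      ((hf.comp hS).contDiff.differentiable (by simp) _).hasFDerivAt
    have hd : ∀ {u : ℝ → ℝ × ℝ} {u' : ℝ × ℝ}, HasDerivAt u u' t → u t = (t, t) →
        HasDerivAt (fun s => S (u s)) (fderiv ℝ S (t, t) u') t := by
      intro u u' hu hut
      rw [← hut] at hfS ⊢
      exact hfS.comp_hasDerivAt t hu
    have h1 := hd ((hasDerivAt_id t).prodMk (hasDerivAt_id t)) rfl
    have h2 := hd ((hasDerivAt_id t).prodMk (hasDerivAt_const t t)) rfl
    have h3 := hd ((hasDerivAt_const t t).prodMk (hasDerivAt_id t)) rfl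
    have h2' := h2.unique (hA.hasDerivAt_comp hf a (A (t • b) y) t)
    have h3' := h3.unique ((hA.hasDerivAt_comp hf b (A (t • a) y) t).congr_of_eventuallyEq
      (.of_forall fun s => by simp only [S, id, hA.comm hY (t • a)]))
    rw [hA.comm hY (t • b) (t • a)] at h3'
    refine h1.congr_deriv ?_
    rw [map_add, Pi.add_apply, map_add, ← h2', ← h3', ← map_add]
    simp
  have h0 := isMIntegralCurve_Ioo_eq_of_contMDiff_boundaryless (t₀ := 0)
    ((hA.smooth (a + b)).of_le (by simp)) hcurve (hA.curve (a + b) y)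
    (by simp [c, hA.zero])
  have := congrFun h0 1
  simpa [c] using this.symm

end IsTimeOneFlow

end Commuting

/-! ### Regular level sets as embedded submanifolds -/

/-- The inverse function theorem: a smooth map with invertible derivative at a point restricts to a
local diffeomorphism around that point. -/
theorem exists_openPartialHomeomorph_of_hasFDerivAt {E F : Type*} [NormedAddCommGroup E]
    [NormedSpace ℝ E] [CompleteSpace E] [NormedAddCommGroup F] [NormedSpace ℝ F]
    {T : E → F} {U : Set E} (hU : IsOpen U)
    (hT : ContDiffOn ℝ ∞ T U) {x₀ : E} (hx₀ : x₀ ∈ U) {T' : E ≃L[ℝ] F}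
    (hT' : HasFDerivAt T (T' : E →L[ℝ] F) x₀) :
    ∃ g : OpenPartialHomeomorph E F, x₀ ∈ g.source ∧ g.source ⊆ U ∧ (∀ x, g x = T x) ∧
      ContDiffOn ℝ ∞ g.symm g.target := by
  have hT₀ : ContDiffAt ℝ ∞ T x₀ := hT.contDiffAt (hU.mem_nhds hx₀)
  let g₀ := hT₀.toOpenPartialHomeomorph T hT' (by simp)
  let W : Set E := U ∩ fderiv ℝ T ⁻¹' range ((↑) : (E ≃L[ℝ] F) → E →L[ℝ] F)
  have hW : IsOpen W := (hT.continuousOn_fderiv_of_isOpen hU (by simp)).isOpen_inter_preimage hU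
    ContinuousLinearEquiv.isOpen
  refine ⟨g₀.restrOpen W hW, ⟨hT₀.mem_toOpenPartialHomeomorph_source hT' (by simp), hx₀,
    T', hT'.fderiv.symm⟩, fun x hx => hx.2.1, fun x => rfl, fun y hy => ?_⟩
  have hy' := (g₀.restrOpen W hW).map_target hy
  obtain ⟨hyg, hyU, e, he⟩ := hy'
  refine ContDiffAt.contDiffWithinAt ?_
  refine (g₀.restrOpen W hW).contDiffAt_symm hy (f₀' := e) ?_ (hT.contDiffAt (hU.mem_nhds hyU))
  rw [he]
  exact ((hT.contDiffAt (hU.mem_nhds hyU)).differentiableAt (by simp)).hasFDerivAt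

section Slice

variable {E : Type*} [NormedAddCommGroup E] [NormedSpace ℝ E]
  {E' : Type*} [NormedAddCommGroup E'] [NormedSpace ℝ E']
  {V : Type*} [NormedAddCommGroup V] [NormedSpace ℝ V] (L : (E' × V) ≃L[ℝ] E)
  {M : Type*} [TopologicalSpace M] [ChartedSpace E M] {S : Set M}

/-- A slice chart of `S` adapted to the splitting `L : E' × V ≃ E` of the model space: a smooth
chart in which `S` is the subspace `E' × 0`. -/
structure IsSliceChart (S : Set M) (e : OpenPartialHomeomorph M E) : Prop where
  mem_maximalAtlas : e ∈ IsManifold.maximalAtlas 𝓘(ℝ, E) ∞ M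
  mem_iff : ∀ y ∈ e.source, y ∈ S ↔ (L.symm (e y)).2 = 0

namespace IsSliceChart

variable {L} {e : OpenPartialHomeomorph M E}

theorem symm_mem (he : IsSliceChart L S e) {u : E'} (hu : L (u, 0) ∈ e.target) :
    e.symm (L (u, 0)) ∈ S := by
  rw [he.mem_iff _ (e.map_target hu), e.right_inv hu, L.symm_apply_apply]

theorem apply_eq (he : IsSliceChart L S e) {y : M} (hy : y ∈ e.source) (hS : y ∈ S) :
    L ((L.symm (e y)).1, 0) = e y := by
  rw [← (he.mem_iff y hy).1 hS, Prod.mk.eta, L.apply_symm_apply]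

open Classical in
/-- The chart `S → E'` induced by a slice chart; `x` is a junk value outside of the target. -/
noncomputable def chart (he : IsSliceChart L S e) (x : S) : OpenPartialHomeomorph S E' where
  toFun y := (L.symm (e y)).1
  invFun u := if h : e.symm (L (u, 0)) ∈ S then ⟨e.symm (L (u, 0)), h⟩ else x
  source := Subtype.val ⁻¹' e.source
  target := (fun u => L (u, 0)) ⁻¹' e.target
  map_source' y hy := by
    rw [mem_preimage, he.apply_eq hy y.2]
    exact e.map_source hy
  map_target' u hu := by
    rw [dif_pos (he.symm_mem hu)]
    exact e.map_target hu
  left_inv' y hy := by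
    have h : e.symm (L ((L.symm (e y)).1, 0)) = y := by
      rw [he.apply_eq hy y.2, e.left_inv hy]
    rw [dif_pos (by rw [h]; exact y.2)]
    exact Subtype.ext h
  right_inv' u hu := by
    rw [dif_pos (he.symm_mem hu)]
    change (L.symm (e (e.symm (L (u, 0))))).1 = u
    rw [e.right_inv hu, L.symm_apply_apply]
  open_source := e.open_source.preimage continuous_subtype_val
  open_target := e.open_target.preimage (L.continuous.comp (by fun_prop))
  continuousOn_toFun := (continuous_fst.comp L.symm.continuous).comp_continuousOn
    (e.continuousOn.comp continuous_subtype_val.continuousOn fun _ hy => hy)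
  continuousOn_invFun := by
    rw [IsInducing.subtypeVal.continuousOn_iff]
    refine (e.continuousOn_symm.comp
      (L.continuous.comp (by fun_prop : Continuous fun u : E' => (u, (0 : V)))).continuousOn
      fun u hu => hu).congr fun u hu => ?_
    rw [Function.comp_apply, dif_pos (he.symm_mem hu)]
    rfl

open Classical in
theorem coe_chart_symm (he : IsSliceChart L S e) (x : S) {u : E'}
    (hu : u ∈ (he.chart x).target) : ((he.chart x).symm u : M) = e.symm (L (u, 0)) := by
  change ((if h : e.symm (L (u, 0)) ∈ S then (⟨e.symm (L (u, 0)), h⟩ : S) else x : S) : M) = _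
  rw [dif_pos (he.symm_mem hu)]

end IsSliceChart

/-- The charted space structure on a subset covered by slice charts. -/
@[reducible]
noncomputable def chartedSpaceOfSlice {c : S → OpenPartialHomeomorph M E}
    (hc : ∀ x, IsSliceChart L S (c x)) (hx : ∀ x, (x : M) ∈ (c x).source) :
    ChartedSpace E' S where
  atlas := range fun x => (hc x).chart x
  chartAt x := (hc x).chart x
  mem_chart_source x := hx x
  chart_mem_atlas x := mem_range_self x

theorem isManifold_ofSlice {c : S → OpenPartialHomeomorph M E}
    (hc : ∀ x, IsSliceChart L S (c x)) (hx : ∀ x, (x : M) ∈ (c x).source) :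
    letI := chartedSpaceOfSlice L hc hx
    IsManifold 𝓘(ℝ, E') ∞ S := by
  let _ := chartedSpaceOfSlice L hc hx
  refine isManifold_of_contDiffOn _ _ _ ?_
  rintro _ _ ⟨x, rfl⟩ ⟨x', rfl⟩
  have h1 : ContMDiffOn 𝓘(ℝ, E) 𝓘(ℝ, E) ∞ ((c x).symm.trans (c x'))
      ((c x).symm.trans (c x')).source :=
    contMDiffOn_of_mem_contDiffGroupoid (IsManifold.compatible_of_mem_maximalAtlas
      (hc x).mem_maximalAtlas (hc x').mem_maximalAtlas)
  have h2 : ContDiff ℝ ∞ fun u : E' => L (u, (0 : V)) :=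
    L.contDiff.comp (contDiff_id.prodMk contDiff_const)
  have h3 : ∀ u ∈ (((hc x).chart x).symm.trans ((hc x').chart x')).source,
      L (u, 0) ∈ ((c x).symm.trans (c x')).source := by
    intro u hu
    refine ⟨hu.1, ?_⟩
    have h4 := hu.2
    change (((hc x).chart x).symm u : M) ∈ (c x').source at h4
    rwa [(hc x).coe_chart_symm x hu.1] at h4
  have h5 := (contDiff_fst.comp L.symm.contDiff).comp_contDiffOn
    (h1.contDiffOn.comp h2.contDiffOn h3)
  refine (h5.congr fun u hu => ?_).mono (by simp)
  change (L.symm (c x' (((hc x).chart x).symm u : M))).1 = (L.symm (c x' ((c x).symm _))).1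
  rw [(hc x).coe_chart_symm x hu.1]

theorem isSmoothEmbedding_ofSlice {c : S → OpenPartialHomeomorph M E}
    (hc : ∀ x, IsSliceChart L S (c x)) (hx : ∀ x, (x : M) ∈ (c x).source) :
    letI := chartedSpaceOfSlice L hc hx
    IsSmoothEmbedding 𝓘(ℝ, E') 𝓘(ℝ, E) ∞ (Subtype.val : S → M) := by
  let _ := chartedSpaceOfSlice L hc hx
  have := isManifold_ofSlice L hc hx
  refine ⟨IsImmersionOfComplement.isImmersion (F := V) fun x => ?_, IsEmbedding.subtypeVal⟩
  refine IsImmersionAtOfComplement.mk_of_charts L ((hc x).chart x) (c x) (hx x) (hx x)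
    (IsManifold.subset_maximalAtlas (mem_range_self x)) (hc x).mem_maximalAtlas
    (fun y hy => hy) fun u hu => ?_
  have hu' : u ∈ ((hc x).chart x).target := by simpa using hu
  change c x (((hc x).chart x).symm u : M) = L (u, 0)
  rw [(hc x).coe_chart_symm x hu', (c x).right_inv hu']

variable [IsManifold 𝓘(ℝ, E) ∞ M] [FiniteDimensional ℝ E] {J : M → V}

/-- A submersion has slice charts along its zero set: complete it to a local diffeomorphism by a
linear projection onto the kernel of its derivative. -/
theorem exists_isSliceChart (hJ : ContMDiff 𝓘(ℝ, E) 𝓘(ℝ, V) ∞ J) {x : M}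
    (hsurj : Function.Surjective (mvfderiv 𝓘(ℝ, E) J x)) :
    ∃ e : OpenPartialHomeomorph M E, IsSliceChart L {y | J y = 0} e ∧ x ∈ e.source := by
  have : FiniteDimensional ℝ (E' × V) := L.symm.toLinearEquiv.finiteDimensional
  have : FiniteDimensional ℝ E' := Module.Finite.of_surjective (LinearMap.fst ℝ E' V)
    LinearMap.fst_surjective
  have : FiniteDimensional ℝ V := Module.Finite.of_surjective (LinearMap.snd ℝ E' V)
    LinearMap.snd_surjective
  let φ := chartAt E x
  have hφ : φ ∈ IsManifold.maximalAtlas 𝓘(ℝ, E) ∞ M := IsManifold.chart_mem_maximalAtlas x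
  have hxφ : x ∈ φ.source := mem_chart_source E x
  have hφs : ContMDiffOn 𝓘(ℝ, E) 𝓘(ℝ, E) ∞ φ.symm φ.target :=
    contMDiffOn_symm_of_mem_maximalAtlas hφ
  let Jφ : E → V := J ∘ φ.symm
  have hJφ : ContDiffOn ℝ ∞ Jφ φ.target := (hJ.comp_contMDiffOn hφs).contDiffOn
  have hd : HasFDerivAt Jφ (fderiv ℝ Jφ (φ x)) (φ x) :=
    ((hJφ.contDiffAt (φ.open_target.mem_nhds (φ.map_source hxφ))).differentiableAt
      (by simp)).hasFDerivAt
  let D : E →L[ℝ] V := fderiv ℝ Jφ (φ x)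
  have hD : LinearMap.range (D : E →ₗ[ℝ] V) = ⊤ := by
    rw [LinearMap.range_eq_top]
    intro w
    obtain ⟨v, hv⟩ := hsurj w
    refine ⟨v, ?_⟩
    rw [← hv]
    have h1 := (hJ.mdifferentiableAt (x := x) (by simp)).mvfderiv
    rw [h1]
    simp [D, Jφ, writtenInExtChartAt, φ, Function.comp_def, chartAt_self_eq]
    rfl
  let K := LinearMap.ker (D : E →ₗ[ℝ] V)
  have hdim : Module.finrank ℝ K = Module.finrank ℝ E' := by
    have h1 := LinearMap.finrank_range_add_finrank_ker (D : E →ₗ[ℝ] V)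
    rw [hD, finrank_top] at h1
    have h2 := L.toLinearEquiv.finrank_eq
    rw [Module.finrank_prod] at h2
    change Module.finrank ℝ V + Module.finrank ℝ K = _ at h1
    omega
  obtain ⟨p, hp⟩ := LinearMap.exists_leftInverse_of_injective K.subtype K.ker_subtype
  let κ : E →ₗ[ℝ] E' := (LinearEquiv.ofFinrankEq K E' hdim).toLinearMap ∘ₗ p
  let T₀ : E →ₗ[ℝ] E := L.toLinearMap ∘ₗ κ.prod (D : E →ₗ[ℝ] V)
  have hT₀ : Function.Injective T₀ := by
    rw [← LinearMap.ker_eq_bot, LinearMap.ker_eq_bot']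
    intro v hv
    have h1 : (κ v, D v) = (0 : E' × V) := L.injective (hv.trans (map_zero L).symm)
    have h2 : v ∈ K := congrArg Prod.snd h1
    have h3 : p v = ⟨v, h2⟩ := LinearMap.congr_fun hp ⟨v, h2⟩
    have h4 : LinearEquiv.ofFinrankEq K E' hdim (p v) = 0 := congrArg Prod.fst h1
    rw [h3, LinearEquiv.map_eq_zero_iff] at h4
    exact congrArg Subtype.val h4
  let T' : E ≃L[ℝ] E := (LinearEquiv.ofInjectiveEndo T₀ hT₀).toContinuousLinearEquiv
  let κ' : E →L[ℝ] E' := LinearMap.toContinuousLinearMap κ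
  -- `J` in the chart `φ`, completed by the projection `κ` onto the kernel of its derivative
  let T : E → E := fun v => L (κ' v, Jφ v)
  have hT : ContDiffOn ℝ ∞ T φ.target :=
    L.contDiff.comp_contDiffOn (κ'.contDiff.contDiffOn.prodMk hJφ)
  have hT' : HasFDerivAt T (T' : E →L[ℝ] E) (φ x) := by
    refine (L.hasFDerivAt.comp (φ x) (κ'.hasFDerivAt.prodMk hd)).congr_fderiv ?_
    ext v
    rfl
  obtain ⟨g, hxg, hgφ, hgT, hgs⟩ :=
    exists_openPartialHomeomorph_of_hasFDerivAt φ.open_target hT (φ.map_source hxφ) hT'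
  refine ⟨φ.trans g, ⟨?_, fun y hy => ?_⟩, ⟨hxφ, hxg⟩⟩
  · refine OpenPartialHomeomorph.mem_maximalAtlas_of_contMDiffOn _ ?_ ?_
    · have h1 : ContMDiffOn 𝓘(ℝ, E) 𝓘(ℝ, E) ∞ g g.source :=
        ((hT.mono hgφ).congr fun v _ => hgT v).contMDiffOn
      exact h1.comp ((contMDiffOn_of_mem_maximalAtlas hφ).mono fun y hy => hy.1) fun y hy => hy.2
    · exact hφs.comp (hgs.contMDiffOn.mono fun y hy => hy.1) fun y hy => hy.2
  · have h1 : (φ.trans g) y = L (κ' (φ y), J y) := by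
      change g (φ y) = _
      rw [hgT]
      simp only [T, Jφ, Function.comp_apply, φ.left_inv hy.1]
    rw [h1, L.symm_apply_apply]
    rfl

end Slice

/-! ### Poisson brackets -/

section Bracket

variable {E : Type*} [NormedAddCommGroup E] [NormedSpace ℝ E]
  {H : Type*} [TopologicalSpace H] {I : ModelWithCorners ℝ E H}
  {M : Type*} [TopologicalSpace M] [ChartedSpace H M] {π : BivectorField I M}

namespace BivectorField

theorem bracket_skew (f g : M → ℝ) (x : M) : π.bracket f g x = -π.bracket g f x :=
  π.skew x _ _

theorem bracket_eq_zero_of_forall_eq_left {f : M → ℝ} {c : ℝ} (hf : ∀ x, f x = c) (g : M → ℝ)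
    (x : M) : π.bracket f g x = 0 := by
  obtain rfl : f = fun _ => c := funext hf
  rw [bracket, mvfderiv_const]
  rfl

theorem bracket_eq_zero_of_forall_eq_right {g : M → ℝ} {c : ℝ} (hg : ∀ x, g x = c) (f : M → ℝ)
    (x : M) : π.bracket f g x = 0 := by
  rw [bracket_skew, bracket_eq_zero_of_forall_eq_left hg, neg_zero]

theorem bracket_neg_left (f g : M → ℝ) (x : M) :
    π.bracket (fun y => -f y) g x = -π.bracket f g x := by
  have : mvfderiv I (fun y => -f y) x = -mvfderiv I f x := mvfderiv_neg
  rw [bracket, this]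
  rfl

variable [IsManifold I ∞ M]

theorem IsPoisson.contMDiff_bracket (hπ : π.IsPoisson) {f g : M → ℝ}
    (hf : ContMDiff I 𝓘(ℝ, ℝ) ∞ f) (hg : ContMDiff I 𝓘(ℝ, ℝ) ∞ g) :
    ContMDiff I 𝓘(ℝ, ℝ) ∞ (π.bracket f g) :=
  hf.mvfderiv_section (hπ.smooth g hg)

/-- The Jacobi identity: bracketing with `h` is a derivation of the bracket. -/
theorem IsPoisson.bracket_bracket (hπ : π.IsPoisson) {f g h : M → ℝ}
    (hf : ContMDiff I 𝓘(ℝ, ℝ) ∞ f) (hg : ContMDiff I 𝓘(ℝ, ℝ) ∞ g)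
    (hh : ContMDiff I 𝓘(ℝ, ℝ) ∞ h) (x : M) :
    π.bracket (π.bracket f g) h x =
      π.bracket (π.bracket f h) g x + π.bracket f (π.bracket g h) x := by
  have h1 := hπ.jacobi f g h hf hg hh x
  have h2 : π.bracket h f = fun y => -π.bracket f h y := funext (bracket_skew h f)
  rw [bracket_skew g, h2, bracket_neg_left, bracket_skew h] at h1
  linarith

end BivectorField

end Bracket

/-! ### Canonical families of Hamiltonians and their moment map -/

section Splitting

variable {E : Type u} [NormedAddCommGroup E] [NormedSpace ℝ E]
  {H : Type*} [TopologicalSpace H] {I : ModelWithCorners ℝ E H}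
  {M : Type*} [TopologicalSpace M] [ChartedSpace H M]
  {V : Type u} [NormedAddCommGroup V] [NormedSpace ℝ V] [FiniteDimensional ℝ V]

/-- The vector-valued function `J` with `Ω(J, c) = μ_c` for all `c`. -/
noncomputable def momentMap (Ω : LinearSymplecticForm V) (μ : V →ₗ[ℝ] (M → ℝ)) (x : M) : V :=
  (Ω.form.toDual Ω.nondegenerate).symm (LinearMap.proj x ∘ₗ μ)

omit [TopologicalSpace M] in
theorem form_momentMap (Ω : LinearSymplecticForm V) (μ : V →ₗ[ℝ] (M → ℝ)) (x : M) (c : V) :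
    Ω.form (momentMap Ω μ x) c = μ c x :=
  LinearMap.BilinForm.apply_toDual_symm_apply (hB := Ω.nondegenerate)
    ((LinearMap.proj (φ := fun _ : M => ℝ) x).comp μ) c

omit [FiniteDimensional ℝ V] in
theorem LinearSymplecticForm.ext_left (Ω : LinearSymplecticForm V) {a b : V}
    (h : ∀ c, Ω.form a c = Ω.form b c) : a = b :=
  sub_eq_zero.1 (Ω.nondegenerate.1 _ fun c => by
    rw [map_sub, LinearMap.sub_apply, h, sub_self])

/-- Functions `μ_a`, linear in the vector `a` of a symplectic vector space, with the canonical
bracket relations `{μ_a, μ_b} = Ω(a, b)`; their Hamiltonian vector fields are the `Y_a`. -/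
structure IsCanonicalFamily (π : BivectorField I M) (Ω : LinearSymplecticForm V)
    (μ : V →ₗ[ℝ] (M → ℝ)) (Y : V →ₗ[ℝ] ((x : M) → TangentSpace I x)) : Prop where
  smooth : ∀ a, ContMDiff I 𝓘(ℝ, ℝ) ∞ (μ a)
  bracket : ∀ a b x, π.bracket (μ a) (μ b) x = Ω.form a b
  hamiltonian : ∀ a x, π.hamiltonian (μ a) x = Y a x

namespace IsCanonicalFamily

variable {π : BivectorField I M} {Ω : LinearSymplecticForm V} {μ : V →ₗ[ℝ] (M → ℝ)}
  {Y : V →ₗ[ℝ] ((x : M) → TangentSpace I x)} {A : V → M → M}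

omit [FiniteDimensional ℝ V] in
theorem mvfderiv_apply (hμ : IsCanonicalFamily π Ω μ Y) (f : M → ℝ) (b : V) (x : M) :
    mvfderiv I f x (Y b x) = π.bracket f (μ b) x := by
  rw [BivectorField.bracket, hμ.hamiltonian]

omit [FiniteDimensional ℝ V] in
/-- Skew-symmetry of `π` turns `dμ_b ∘ π^♯` into evaluation on `Y_b`, up to sign. -/
theorem mvfderiv_sharp (hμ : IsCanonicalFamily π Ω μ Y) (b : V) (x : M)
    (α : TangentSpace I x →L[ℝ] ℝ) : mvfderiv I (μ b) x (π.sharp x α) = -α (Y b x) := by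
  rw [π.skew, ← hμ.hamiltonian]
  rfl

theorem contMDiff_momentMap (hμ : IsCanonicalFamily π Ω μ Y) :
    ContMDiff I 𝓘(ℝ, V) ∞ (momentMap Ω μ) := by
  let b := Module.finBasis ℝ V
  have h : momentMap Ω μ =
      fun x => ∑ i, μ (b i) x • (Ω.form.toDual Ω.nondegenerate).symm (b.coord i) := by
    funext x
    refine Ω.ext_left fun c => ?_
    rw [form_momentMap, map_sum, LinearMap.sum_apply]
    simp_rw [map_smul, LinearMap.smul_apply,
      LinearMap.BilinForm.apply_toDual_symm_apply (hB := Ω.nondegenerate)]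
    have hc := congrArg (fun c => μ c x) (b.sum_repr c)
    simp only [map_sum, map_smul, Finset.sum_apply, Pi.smul_apply, smul_eq_mul] at hc
    simp only [Module.Basis.coord_apply, smul_eq_mul, ← hc, mul_comm]
  rw [h]
  exact contMDiff_finsetSum fun i _ => (hμ.smooth _).smul contMDiff_const

theorem form_mvfderiv_momentMap (hμ : IsCanonicalFamily π Ω μ Y) (x : M) (v : TangentSpace I x)
    (c : V) : Ω.form (mvfderiv I (momentMap Ω μ) x v) c = mvfderiv I (μ c) x v := by
  have h := mvfderiv_clm_comp_apply (LinearMap.toContinuousLinearMap (Ω.form.flip c))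
    (hμ.contMDiff_momentMap.mdifferentiableAt (x := x) (by simp)) v
  have h' : (fun y => LinearMap.toContinuousLinearMap (Ω.form.flip c) (momentMap Ω μ y)) = μ c :=
    funext fun y => form_momentMap Ω μ y c
  rw [h'] at h
  exact h.symm

theorem mvfderiv_momentMap (hμ : IsCanonicalFamily π Ω μ Y) (b : V) (x : M) :
    mvfderiv I (momentMap Ω μ) x (Y b x) = -b := by
  refine Ω.ext_left fun c => ?_
  rw [hμ.form_mvfderiv_momentMap, hμ.mvfderiv_apply, hμ.bracket, map_neg, LinearMap.neg_apply,
    Ω.alt.neg_eq]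

theorem surjective_mvfderiv_momentMap (hμ : IsCanonicalFamily π Ω μ Y) (x : M) :
    Function.Surjective (mvfderiv I (momentMap Ω μ) x) := fun b =>
  ⟨Y (-b) x, by rw [hμ.mvfderiv_momentMap, neg_neg]⟩

variable [IsManifold I ∞ M]

omit [FiniteDimensional ℝ V] in
theorem commutes (hμ : IsCanonicalFamily π Ω μ Y) (hπ : π.IsPoisson) :
    IsTimeOneFlow.Commutes Y := by
  intro a b f hf x
  simp_rw [hμ.mvfderiv_apply]
  change π.bracket (π.bracket f (μ b)) (μ a) x = π.bracket (π.bracket f (μ a)) (μ b) x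
  rw [hπ.bracket_bracket hf (hμ.smooth b) (hμ.smooth a),
    BivectorField.bracket_eq_zero_of_forall_eq_right (hμ.bracket b a), add_zero]

/-- The flow of `Y_a` moves `J` with constant velocity `-a`. -/
theorem momentMap_flow (hμ : IsCanonicalFamily π Ω μ Y) (hA : IsTimeOneFlow Y A) (a : V) (y : M) :
    momentMap Ω μ (A a y) = momentMap Ω μ y - a := by
  have h : ∀ t : ℝ, HasDerivAt (fun s : ℝ => momentMap Ω μ (A (s • a) y) + s • a) 0 t := by
    intro t
    have h1 := (hA.curve a y t).hasDerivAt_comp_curve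
      (hμ.contMDiff_momentMap.mdifferentiableAt (by simp))
    rw [hμ.mvfderiv_momentMap] at h1
    have h2 := h1.add ((hasDerivAt_id t).smul_const a)
    rw [one_smul, neg_add_cancel] at h2
    exact h2
  have h0 := is_const_of_deriv_eq_zero (fun t => (h t).differentiableAt) (fun t => (h t).deriv) 1 0
  simp only [one_smul, zero_smul, add_zero, hA.zero] at h0
  rw [← h0, add_sub_cancel_right]

omit [FiniteDimensional ℝ V] in
/-- A smooth function annihilated by the `Y_b` is invariant under the flow. -/
theorem flow_invariant (hμ : IsCanonicalFamily π Ω μ Y) (hA : IsTimeOneFlow Y A) {f : M → ℝ}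
    (hf : ContMDiff I 𝓘(ℝ, ℝ) ∞ f) (h : ∀ b x, π.bracket f (μ b) x = 0) (a : V) (y : M) :
    f (A a y) = f y := by
  have h1 : ∀ t : ℝ, HasDerivAt (fun s : ℝ => f (A (s • a) y)) 0 t := fun t => by
    have := hA.hasDerivAt_comp hf a y t
    rwa [hμ.mvfderiv_apply, h] at this
  have h0 := is_const_of_deriv_eq_zero (fun t => (h1 t).differentiableAt)
    (fun t => (h1 t).deriv) 1 0
  simpa [hA.zero] using h0

end IsCanonicalFamily

end Splitting

/-! ### The zero slice of the moment map and the splitting -/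

section Reduction

variable {E : Type u} [NormedAddCommGroup E] [NormedSpace ℝ E]
  {H : Type*} [TopologicalSpace H] {I : ModelWithCorners ℝ E H}
  {M : Type*} [TopologicalSpace M] [ChartedSpace H M]
  {V : Type u} [NormedAddCommGroup V] [NormedSpace ℝ V] [FiniteDimensional ℝ V]
  {π : BivectorField I M} {Ω : LinearSymplecticForm V} {μ : V →ₗ[ℝ] (M → ℝ)}
  {Y : V →ₗ[ℝ] ((x : M) → TangentSpace I x)} {A : V → M → M}
  {E' : Type*} [NormedAddCommGroup E'] [NormedSpace ℝ E']
  {H' : Type*} [TopologicalSpace H'] {I' : ModelWithCorners ℝ E' H'}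
  {N : Type*} [TopologicalSpace N] [ChartedSpace H' N]
  {ι : N → M} {p : M → N}

variable (I I') in
/-- The derivative of the projection `p` at a point `ι n` of the slice, with values in `T_n N`.
The recasting from `T_{p (ι n)} N` is meaningful when `p (ι n) = n`; it is definitional because all
tangent spaces of `N` are the model space. -/
noncomputable def sliceDeriv (ι : N → M) (p : M → N) (n : N) :
    TangentSpace I (ι n) →L[ℝ] TangentSpace I' n :=
  show TangentSpace I (ι n) →L[ℝ] TangentSpace I' (p (ι n)) from mfderiv I I' p (ι n)

variable (I') in
/-- The bivector field induced on the slice `N` by pushing `π` forward along the projection. -/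
noncomputable def reducedBivector (π : BivectorField I M) (ι : N → M) (p : M → N) :
    BivectorField I' N where
  sharp n :=
    { toFun := fun β => sliceDeriv I I' ι p n (π.sharp (ι n) (β.comp (sliceDeriv I I' ι p n)))
      map_add' := fun β β' => by
        rw [ContinuousLinearMap.add_comp, map_add, map_add]
      map_smul' := fun r β => by
        rw [ContinuousLinearMap.smul_comp, map_smul, map_smul, RingHom.id_apply] }
  skew n α β := π.skew (ι n) (α.comp (sliceDeriv I I' ι p n)) (β.comp (sliceDeriv I I' ι p n))

theorem sliceDeriv_reducedBivector (π : BivectorField I M) (n : N)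
    (β : TangentSpace I' n →L[ℝ] ℝ) : (reducedBivector I' π ι p).sharp n β =
      sliceDeriv I I' ι p n (π.sharp (ι n) (β.comp (sliceDeriv I I' ι p n))) :=
  rfl

variable (I I') in
/-- An embedded zero level `ι : N → M` of the moment map, together with the projection
`y ↦ A (J y) y` of `M` onto it along the flow. -/
structure IsZeroSlice (Ω : LinearSymplecticForm V) (μ : V →ₗ[ℝ] (M → ℝ)) (A : V → M → M)
    (ι : N → M) (p : M → N) : Prop where
  isSmoothEmbedding : IsSmoothEmbedding I' I ∞ ι
  momentMap_eq : ∀ n, momentMap Ω μ (ι n) = 0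
  incl_proj : ∀ y, ι (p y) = A (momentMap Ω μ y) y

namespace IsZeroSlice

theorem contMDiff_incl (hs : IsZeroSlice I I' Ω μ A ι p) : ContMDiff I' I ∞ ι :=
  hs.isSmoothEmbedding.contMDiff

theorem mvfderiv_momentMap_mfderiv_incl (hs : IsZeroSlice I I' Ω μ A ι p)
    (hμ : IsCanonicalFamily π Ω μ Y) (n : N) (w : TangentSpace I' n) :
    mvfderiv I (momentMap Ω μ) (ι n) (mfderiv I' I ι n w) = 0 := by
  refine Ω.ext_left fun c => ?_
  rw [hμ.form_mvfderiv_momentMap, map_zero, LinearMap.zero_apply]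
  refine (mvfderiv_comp_apply n ((hμ.smooth c).mdifferentiableAt (by simp))
    (hs.contMDiff_incl.mdifferentiableAt (by simp)) w).symm.trans ?_
  have h : μ c ∘ ι = fun _ => 0 := funext fun n => by
    rw [Function.comp_apply, ← form_momentMap Ω μ, hs.momentMap_eq, map_zero, LinearMap.zero_apply]
  rw [h, mvfderiv_const]
  rfl

variable [IsManifold I ∞ M]

theorem proj_incl (hs : IsZeroSlice I I' Ω μ A ι p) (hA : IsTimeOneFlow Y A) (n : N) :
    p (ι n) = n :=
  hs.isSmoothEmbedding.isEmbedding.injective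
    (by rw [hs.incl_proj, hs.momentMap_eq, hA.zero])

variable [FiniteDimensional ℝ E] [I.Boundaryless] [T2Space M]

/-- The projection is constant along the orbits of the flow. -/
theorem proj_flow (hs : IsZeroSlice I I' Ω μ A ι p) (hA : IsTimeOneFlow Y A)
    (hμ : IsCanonicalFamily π Ω μ Y) (hπ : π.IsPoisson) (a : V) (y : M) : p (A a y) = p y :=
  hs.isSmoothEmbedding.isEmbedding.injective (by
    rw [hs.incl_proj, hs.incl_proj, hμ.momentMap_flow hA, ← hA.add (hμ.commutes hπ),
      sub_add_cancel])

theorem contMDiff_proj (hs : IsZeroSlice I I' Ω μ A ι p) (hA : IsTimeOneFlow Y A)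
    (hμ : IsCanonicalFamily π Ω μ Y) : ContMDiff I I' ∞ p := by
  have h : ContMDiff I I ∞ (ι ∘ p) := by
    rw [show ι ∘ p = fun y => A (momentMap Ω μ y) y from funext hs.incl_proj]
    exact hA.contMDiff_comp hμ.contMDiff_momentMap contMDiff_id
  exact (ContMDiff.iff_comp_isImmersion hs.isSmoothEmbedding.isImmersion).2
    ⟨hs.isSmoothEmbedding.isEmbedding.continuous_iff.2 h.continuous, h⟩

/-- The derivative of a function on the slice along a projected vector. -/
theorem mvfderiv_sliceDeriv (hs : IsZeroSlice I I' Ω μ A ι p) (hA : IsTimeOneFlow Y A)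
    (hμ : IsCanonicalFamily π Ω μ Y) {f : N → ℝ} (hf : ContMDiff I' 𝓘(ℝ, ℝ) ∞ f) (n : N) :
    (mvfderiv I' f n).comp (sliceDeriv I I' ι p n) = mvfderiv I (f ∘ p) (ι n) := by
  rw [mvfderiv_comp (ι n) (hf.mdifferentiableAt (by simp))
    ((hs.contMDiff_proj hA hμ).mdifferentiableAt (by simp))]
  have : ∀ n' : N, n' = n → (mvfderiv I' f n : E' →L[ℝ] ℝ) = (mvfderiv I' f n' : E' →L[ℝ] ℝ) := by
    rintro _ rfl
    rfl
  exact congrArg (fun T : E' →L[ℝ] ℝ => T.comp (mfderiv I I' p (ι n) : E →L[ℝ] E'))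
    (this _ (hs.proj_incl hA n))

theorem reducedBivector_hamiltonian (hs : IsZeroSlice I I' Ω μ A ι p) (hA : IsTimeOneFlow Y A)
    (hμ : IsCanonicalFamily π Ω μ Y) {f : N → ℝ} (hf : ContMDiff I' 𝓘(ℝ, ℝ) ∞ f) (n : N) :
    (reducedBivector I' π ι p).hamiltonian f n =
      sliceDeriv I I' ι p n (π.hamiltonian (f ∘ p) (ι n)) := by
  rw [BivectorField.hamiltonian, sliceDeriv_reducedBivector, hs.mvfderiv_sliceDeriv hA hμ hf]
  rfl

theorem reducedBivector_bracket (hs : IsZeroSlice I I' Ω μ A ι p) (hA : IsTimeOneFlow Y A)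
    (hμ : IsCanonicalFamily π Ω μ Y) {f g : N → ℝ} (hf : ContMDiff I' 𝓘(ℝ, ℝ) ∞ f)
    (hg : ContMDiff I' 𝓘(ℝ, ℝ) ∞ g) (n : N) :
    (reducedBivector I' π ι p).bracket f g n = π.bracket (f ∘ p) (g ∘ p) (ι n) := by
  rw [BivectorField.bracket, hs.reducedBivector_hamiltonian hA hμ hg, BivectorField.bracket,
    ← hs.mvfderiv_sliceDeriv hA hμ hf]
  rfl

variable [FiniteDimensional ℝ E'] [IsManifold I' ∞ N] [T2Space N]

theorem sliceDeriv_mfderiv_incl (hs : IsZeroSlice I I' Ω μ A ι p) (hA : IsTimeOneFlow Y A)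
    (hμ : IsCanonicalFamily π Ω μ Y) (n : N) (w : TangentSpace I' n) :
    sliceDeriv I I' ι p n (mfderiv I' I ι n w) = w := by
  refine tangent_eq_of_forall_mvfderiv fun f hf => ?_
  have h1 := congrArg (fun T => T (mfderiv I' I ι n w)) (hs.mvfderiv_sliceDeriv hA hμ hf n)
  refine h1.trans ?_
  have hfp := hf.comp (hs.contMDiff_proj hA hμ)
  refine (mvfderiv_comp_apply n (hfp.mdifferentiableAt (by simp))
    (hs.contMDiff_incl.mdifferentiableAt (by simp)) w).symm.trans ?_
  rw [show (f ∘ p) ∘ ι = f from funext fun n => congrArg f (hs.proj_incl hA n)]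

omit [FiniteDimensional ℝ E'] [IsManifold I' ∞ N] [T2Space N] in
/-- The chain rule for `y ↦ A (J y) y` at a point of the slice: the projection moves `v` along the
fields `Y_b` into the tangent space of the slice. -/
theorem mfderiv_incl_sliceDeriv (hs : IsZeroSlice I I' Ω μ A ι p) (hA : IsTimeOneFlow Y A)
    (hμ : IsCanonicalFamily π Ω μ Y) (n : N) (v : TangentSpace I (ι n)) :
    mfderiv I' I ι n (sliceDeriv I I' ι p n v) =
      v + Y (mvfderiv I (momentMap Ω μ) (ι n) v) (ι n) := by
  refine tangent_eq_of_forall_mvfderiv fun f hf => ?_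
  have hfι := hf.comp hs.contMDiff_incl
  refine (mvfderiv_comp_apply n (hf.mdifferentiableAt (by simp))
    (hs.contMDiff_incl.mdifferentiableAt (by simp)) _).symm.trans ?_
  refine (congrArg (fun T => T v) (hs.mvfderiv_sliceDeriv hA hμ hfι n)).trans ?_
  let G : V × M → ℝ := fun q => f (A q.1 q.2)
  have hG : ContMDiff (𝓘(ℝ, V).prod I) 𝓘(ℝ, ℝ) ∞ G := hf.comp hA.contMDiff
  have hJ := hμ.contMDiff_momentMap
  let w : V := mvfderiv I (momentMap Ω μ) (ι n) v
  have h1 : ((f ∘ ι) ∘ p) = G ∘ fun y => (momentMap Ω μ y, y) :=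
    funext fun y => congrArg f (hs.incl_proj y)
  rw [h1, mvfderiv_comp_apply_of_eq (f := fun y => (momentMap Ω μ y, y))
    (y := ((0 : V), ι n)) (ι n) (hG.mdifferentiableAt (by simp))
    ((hJ.prodMk contMDiff_id).mdifferentiableAt (by simp)) (by rw [hs.momentMap_eq])]
  have h2 : mfderiv I (𝓘(ℝ, V).prod I) (fun y => (momentMap Ω μ y, y)) (ι n) v = (w, v) := by
    have := mfderiv_prodMk (hJ.mdifferentiableAt (x := ι n) (by simp))
      (mdifferentiableAt_id (I := I) (x := ι n))
    exact (congrArg (fun T => T v) this).trans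
      (congrArg (fun u => (w, u)) (congrArg (fun T => T v) (mfderiv_id (I := I) (x := ι n))))
  refine (congrArg (fun u => mvfderiv _ G ((0 : V), ι n) u) h2).trans ?_
  have h3 := mfderiv_prod_eq_add_apply (I := 𝓘(ℝ, V)) (I' := I) (p := ((0 : V), ι n))
    (v := show TangentSpace (𝓘(ℝ, V).prod I) ((0 : V), ι n) from ((w, v) : V × E))
    (hG.mdifferentiableAt (by simp))
  refine h3.trans ?_
  have h4 : (fun z : M => G (((0 : V), ι n).1, z)) = f :=
    funext fun z => congrArg f (hA.zero z)
  have h5 : mfderiv 𝓘(ℝ, V) 𝓘(ℝ, ℝ) (fun z : V => G (z, ((0 : V), ι n).2)) ((0 : V), ι n).1 w =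
      mvfderiv I f (ι n) (Y w (ι n)) := by
    have h6 := hA.hasDerivAt_comp_zero hf w (ι n)
    have h7 : DifferentiableAt ℝ (fun z : V => f (A z (ι n))) 0 :=
      (ContMDiff.contDiff (hf.comp (hA.contMDiff_comp contMDiff_id contMDiff_const))).differentiable
        (by simp) 0
    have h8 := ((hasDerivAt_id (0 : ℝ)).smul_const w)
    refine (congrArg (fun T : V →L[ℝ] ℝ => T w) mfderiv_eq_fderiv).trans ?_
    have h9 := (h7.hasFDerivAt.comp_hasDerivAt_of_eq 0 h8 (by simp))
    have := h9.unique h6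
    rwa [one_smul] at this
  rw [h4]
  refine (congrArg (· + _) h5).trans ?_
  rw [add_comm, map_add]
  rfl

/-- The fields `Y_b` are vertical for the projection, as it is constant along their flows. -/
theorem mfderiv_proj_field (hs : IsZeroSlice I I' Ω μ A ι p) (hA : IsTimeOneFlow Y A)
    (hμ : IsCanonicalFamily π Ω μ Y) (hπ : π.IsPoisson) (b : V) (y : M) :
    mfderiv I I' p y (Y b y) = 0 := by
  refine tangent_eq_of_forall_mvfderiv fun f hf => ?_
  have hp := hs.contMDiff_proj hA hμ
  refine (mvfderiv_comp_apply y (hf.mdifferentiableAt (by simp))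
    (hp.mdifferentiableAt (by simp)) (Y b y)).symm.trans ?_
  have h1 := hA.hasDerivAt_comp_zero (hf.comp hp) b y
  simp only [Function.comp_apply, hs.proj_flow hA hμ hπ] at h1
  rw [map_zero]
  exact h1.unique (hasDerivAt_const _ _)

/-- Functions pulled back from the slice commute with the `μ_b`. -/
theorem bracket_comp_proj (hs : IsZeroSlice I I' Ω μ A ι p) (hA : IsTimeOneFlow Y A)
    (hμ : IsCanonicalFamily π Ω μ Y) (hπ : π.IsPoisson) {f : N → ℝ}
    (hf : ContMDiff I' 𝓘(ℝ, ℝ) ∞ f) (b : V) (y : M) : π.bracket (f ∘ p) (μ b) y = 0 := by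
  rw [← hμ.mvfderiv_apply]
  refine (mvfderiv_comp_apply y (hf.mdifferentiableAt (by simp))
    ((hs.contMDiff_proj hA hμ).mdifferentiableAt (by simp)) (Y b y)).trans ?_
  rw [hs.mfderiv_proj_field hA hμ hπ, map_zero]

/-- The projection intertwines the brackets of `M` and of the slice: by the Jacobi identity the
bracket of two pulled back functions commutes with the `μ_b`, hence is invariant under the flow. -/
theorem bracket_comp_comp (hs : IsZeroSlice I I' Ω μ A ι p) (hA : IsTimeOneFlow Y A)
    (hμ : IsCanonicalFamily π Ω μ Y) (hπ : π.IsPoisson) {f g : N → ℝ}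
    (hf : ContMDiff I' 𝓘(ℝ, ℝ) ∞ f) (hg : ContMDiff I' 𝓘(ℝ, ℝ) ∞ g) :
    π.bracket (f ∘ p) (g ∘ p) = (reducedBivector I' π ι p).bracket f g ∘ p := by
  funext y
  have hp := hs.contMDiff_proj hA hμ
  have hfp := hf.comp hp
  have hgp := hg.comp hp
  rw [Function.comp_apply, hs.reducedBivector_bracket hA hμ hf hg, hs.incl_proj]
  refine (hμ.flow_invariant hA (hπ.contMDiff_bracket hfp hgp) (fun b x => ?_) _ y).symm
  rw [hπ.bracket_bracket hfp hgp (hμ.smooth b),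
    BivectorField.bracket_eq_zero_of_forall_eq_left (hs.bracket_comp_proj hA hμ hπ hf b),
    BivectorField.bracket_eq_zero_of_forall_eq_right (hs.bracket_comp_proj hA hμ hπ hg b),
    add_zero]

omit [FiniteDimensional ℝ E'] [T2Space N] in
/-- The Hamiltonian vector field of `f` on the slice is the restriction of `dp (X_{f ∘ p})`. -/
theorem isSmooth_reducedBivector (hs : IsZeroSlice I I' Ω μ A ι p) (hA : IsTimeOneFlow Y A)
    (hμ : IsCanonicalFamily π Ω μ Y) (hπ : π.IsPoisson) :
    (reducedBivector I' π ι p).IsSmooth := by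
  intro f hf
  have hp := hs.contMDiff_proj hA hμ
  have h1 := (hp.contMDiff_tangentMap (m := ∞) (by simp)).comp
    ((hπ.smooth _ (hf.comp hp)).comp hs.contMDiff_incl)
  refine h1.congr fun n => ?_
  rw [hs.reducedBivector_hamiltonian hA hμ hf]
  have : ∀ (n' : N) (w : E'), n' = n →
      (⟨n, w⟩ : TangentBundle I' N) = (⟨n', w⟩ : TangentBundle I' N) := by
    rintro _ w rfl
    rfl
  exact this _ _ (hs.proj_incl hA n)

theorem isPoisson_reducedBivector (hs : IsZeroSlice I I' Ω μ A ι p) (hA : IsTimeOneFlow Y A)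
    (hμ : IsCanonicalFamily π Ω μ Y) (hπ : π.IsPoisson) :
    (reducedBivector I' π ι p).IsPoisson where
  smooth := hs.isSmooth_reducedBivector hA hμ hπ
  jacobi f g h hf hg hh n := by
    have hsm {a b : N → ℝ} (ha : ContMDiff I' 𝓘(ℝ, ℝ) ∞ a) (hb : ContMDiff I' 𝓘(ℝ, ℝ) ∞ b) :
        ContMDiff I' 𝓘(ℝ, ℝ) ∞ ((reducedBivector I' π ι p).bracket a b) :=
      ha.mvfderiv_section (hs.isSmooth_reducedBivector hA hμ hπ b hb)
    have hp := hs.contMDiff_proj hA hμ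
    rw [hs.reducedBivector_bracket hA hμ hf (hsm hg hh),
      hs.reducedBivector_bracket hA hμ hg (hsm hh hf),
      hs.reducedBivector_bracket hA hμ hh (hsm hf hg),
      ← hs.bracket_comp_comp hA hμ hπ hg hh, ← hs.bracket_comp_comp hA hμ hπ hh hf,
      ← hs.bracket_comp_comp hA hμ hπ hf hg]
    exact hπ.jacobi _ _ _ (hf.comp hp) (hg.comp hp) (hh.comp hp) (ι n)

/-- The fields `Y_b` span a complement of `TN` which is `π`-orthogonal to `TN`, so `π` decomposes
along the slice. -/
theorem isPoissonDirac (hs : IsZeroSlice I I' Ω μ A ι p) (hA : IsTimeOneFlow Y A)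
    (hμ : IsCanonicalFamily π Ω μ Y) (hπ : π.IsPoisson) :
    IsPoissonDirac π ι (reducedBivector I' π ι p) where
  smooth := hs.isSmooth_reducedBivector hA hμ hπ
  transverse n α hα hr := by
    -- `α` kills `TN`, so it is the differential of `μ_b` for some `b`
    let b : V := Ω.sharp (LinearMap.toContinuousLinearMap
      ((α.toLinearMap.comp (LinearMap.proj (ι n))).comp Y))
    have hb : ∀ c, Ω.form b c = α (Y c (ι n)) := fun c => Ω.form_sharp _ c
    have hα' : α = mvfderiv I (μ b) (ι n) := by
      ext v
      have h1 := hα (sliceDeriv I I' ι p n v)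
      rw [hs.mfderiv_incl_sliceDeriv hA hμ, map_add, ← hb, ← Ω.alt.neg_eq,
        hμ.form_mvfderiv_momentMap] at h1
      linarith
    obtain ⟨w, hw⟩ := hr
    have h2 : π.sharp (ι n) α = Y b (ι n) := by
      rw [hα', ← hμ.hamiltonian]
      rfl
    have h3 := hs.mvfderiv_momentMap_mfderiv_incl hμ n w
    rw [hw, h2, hμ.mvfderiv_momentMap, neg_eq_zero] at h3
    rw [h2, h3, map_zero]
    rfl
  induced n α hr := by
    obtain ⟨w, hw⟩ := hr
    -- `α` vanishes on the complement spanned by the `Y_b`, because `π^♯ α` is tangent to `N`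
    have h1 : ∀ b, α (Y b (ι n)) = 0 := fun b => by
      have h2 := hμ.mvfderiv_sharp b (ι n) α
      rw [← hw, ← hμ.form_mvfderiv_momentMap, hs.mvfderiv_momentMap_mfderiv_incl hμ, map_zero,
        LinearMap.zero_apply] at h2
      linarith
    have h2 : (α.comp (mfderiv I' I ι n)).comp (sliceDeriv I I' ι p n) = α := by
      ext v
      change α (mfderiv I' I ι n (sliceDeriv I I' ι p n v)) = α v
      rw [hs.mfderiv_incl_sliceDeriv hA hμ, map_add, h1, add_zero]
    rw [sliceDeriv_reducedBivector, h2, ← hw, hs.sliceDeriv_mfderiv_incl hA hμ]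

/-- The splitting `M ≃ V × N`, `y ↦ (J y, A (J y) y)`. -/
noncomputable def splitting (hs : IsZeroSlice I I' Ω μ A ι p) (hA : IsTimeOneFlow Y A)
    (hμ : IsCanonicalFamily π Ω μ Y) (hπ : π.IsPoisson) :
    Diffeomorph I (𝓘(ℝ, V).prod I') M (V × N) ∞ where
  toFun y := (momentMap Ω μ y, p y)
  invFun q := A (-q.1) (ι q.2)
  left_inv y := by
    change A (-momentMap Ω μ y) (ι (p y)) = y
    rw [hs.incl_proj, ← hA.add (hμ.commutes hπ), neg_add_cancel, hA.zero]
  right_inv q := by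
    refine Prod.ext ?_ ?_
    · change momentMap Ω μ (A (-q.1) (ι q.2)) = q.1
      rw [hμ.momentMap_flow hA, hs.momentMap_eq, zero_sub, neg_neg]
    · change p (A (-q.1) (ι q.2)) = q.2
      rw [hs.proj_flow hA hμ hπ, hs.proj_incl hA]
  contMDiff_toFun := hμ.contMDiff_momentMap.prodMk (hs.contMDiff_proj hA hμ)
  contMDiff_invFun := hA.contMDiff_comp
    ((contDiff_neg (𝕜 := ℝ) (F := V)).contMDiff.comp contMDiff_fst)
    (hs.contMDiff_incl.comp contMDiff_snd)

/-- The covectors of `V` and of `N` are treated separately: the former pull back to the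
differentials of the `μ_b`, the latter to covectors which `π^♯` maps into the kernel of `dJ`. -/
theorem isPoissonMap_splitting (hs : IsZeroSlice I I' Ω μ A ι p) (hA : IsTimeOneFlow Y A)
    (hμ : IsCanonicalFamily π Ω μ Y) (hπ : π.IsPoisson) :
    IsPoissonMap π (Ω.inv.prod (reducedBivector I' π ι p)) (hs.splitting hA hμ hπ) := by
  intro x β
  have hp := hs.contMDiff_proj hA hμ
  have hD : ∀ v : TangentSpace I x, mfderiv I (𝓘(ℝ, V).prod I') (hs.splitting hA hμ hπ) x v =
      ((mvfderiv I (momentMap Ω μ) x v, mfderiv I I' p x v) : V × E') := fun v =>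
    congrArg (fun T => T v) (mfderiv_prodMk
      (hμ.contMDiff_momentMap.mdifferentiableAt (x := x) (by simp))
      (hp.mdifferentiableAt (x := x) (by simp)))
  let β₁ : V →L[ℝ] ℝ := (show V × E' →L[ℝ] ℝ from β).comp (ContinuousLinearMap.inl ℝ V E')
  let β₂ : TangentSpace I' (p x) →L[ℝ] ℝ :=
    (show V × E' →L[ℝ] ℝ from β).comp (ContinuousLinearMap.inr ℝ V E')
  let α₂ : TangentSpace I x →L[ℝ] ℝ := β₂.comp (mfderiv I I' p x)
  -- the first component of `β` pulls back to the differential of `μ_b`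
  let b : V := -Ω.sharp β₁
  have hb : ∀ v : TangentSpace I x,
      β₁ (mvfderiv I (momentMap Ω μ) x v) = mvfderiv I (μ b) x v := fun v => by
    rw [← Ω.form_sharp, ← hμ.form_mvfderiv_momentMap, ← Ω.alt.neg_eq, map_neg]
  have hβ : β.comp (mfderiv I (𝓘(ℝ, V).prod I') (hs.splitting hA hμ hπ) x) =
      mvfderiv I (μ b) x + α₂ := by
    ext v
    rw [add_apply, ← hb]
    have h1 : ∀ (a : V) (c : E'), (show V × E' →L[ℝ] ℝ from β) (a, c) =
        β₁ a + (show V × E' →L[ℝ] ℝ from β) (0, c) := fun a c => by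
      rw [show β₁ a = (show V × E' →L[ℝ] ℝ from β) (a, 0) from rfl, ← map_add]
      simp
    exact (congrArg (fun u => (show V × E' →L[ℝ] ℝ from β) u) (hD v)).trans (h1 _ _)
  have hsharp : π.sharp x (mvfderiv I (μ b) x) = Y b x := hμ.hamiltonian b x
  have hJ : mvfderiv I (momentMap Ω μ) x (π.sharp x α₂) = 0 := by
    refine Ω.ext_left fun c => ?_
    rw [hμ.form_mvfderiv_momentMap, hμ.mvfderiv_sharp, map_zero, LinearMap.zero_apply]
    change -β₂ (mfderiv I I' p x (Y c x)) = 0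
    rw [hs.mfderiv_proj_field hA hμ hπ, map_zero, neg_zero]
  have hN : mfderiv I I' p x (π.sharp x α₂) = (reducedBivector I' π ι p).sharp (p x) β₂ := by
    obtain ⟨g, hg, hgβ⟩ := exists_contMDiff_mvfderiv_eq (I := I') (p x) β₂
    have hα₂ : α₂ = mvfderiv I (g ∘ p) x := by
      rw [mvfderiv_comp x (hg.mdifferentiableAt (by simp)) (hp.mdifferentiableAt (by simp)), hgβ]
    refine tangent_eq_of_forall_mvfderiv fun f hf => ?_
    refine (mvfderiv_comp_apply x (hf.mdifferentiableAt (by simp))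
      (hp.mdifferentiableAt (by simp)) _).symm.trans ?_
    rw [hα₂, ← hgβ]
    exact congrFun (hs.bracket_comp_comp hA hμ hπ hf hg) x
  rw [hβ, map_add, hsharp]
  refine (hD _).trans ?_
  refine Prod.ext ?_ ?_
  · change mvfderiv I (momentMap Ω μ) x (Y b x + π.sharp x α₂) = Ω.sharp β₁
    rw [map_add, hJ, hμ.mvfderiv_momentMap, add_zero, neg_neg]
  · change mfderiv I I' p x (Y b x + π.sharp x α₂) = (reducedBivector I' π ι p).sharp (p x) β₂
    rw [map_add, hs.mfderiv_proj_field hA hμ hπ, hN, zero_add]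

end IsZeroSlice

end Reduction

/-! ### Casimir functions and complete families of vector fields -/

section Complete

variable {E : Type u} [NormedAddCommGroup E] [NormedSpace ℝ E] [CompleteSpace E]
  {H : Type*} [TopologicalSpace H] {I : ModelWithCorners ℝ E H} [I.Boundaryless]
  {M : Type*} [TopologicalSpace M] [ChartedSpace H M] [IsManifold I ∞ M] [T2Space M]
  {V : Type u} [NormedAddCommGroup V] [NormedSpace ℝ V]

omit [CompleteSpace E] in
/-- Complete smooth vector fields `Y_a`, linear in `a`, have time-one flows. -/
theorem exists_isTimeOneFlow (Y : V →ₗ[ℝ] ((x : M) → TangentSpace I x))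
    (hY : ∀ a, ContMDiff I I.tangent ∞ (fun x => (⟨x, Y a x⟩ : TangentBundle I M)))
    (hc : ∀ a x, ∃ γ : ℝ → M, γ 0 = x ∧ IsMIntegralCurve γ (Y a)) :
    ∃ A : V → M → M, IsTimeOneFlow Y A := by
  choose γ hγ0 hγ using hc
  -- by uniqueness, the curve of `t • a` is the curve of `a`, run at speed `t`
  have key : ∀ (t : ℝ) a y, γ (t • a) y 1 = γ a y t := by
    intro t a y
    have h1 : IsMIntegralCurve (γ a y ∘ (· * t)) (Y (t • a)) := by
      rw [map_smul]
      exact (hγ a y).comp_mul t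
    have h2 := isMIntegralCurve_Ioo_eq_of_contMDiff_boundaryless (t₀ := 0)
      ((hY (t • a)).of_le (by simp)) (hγ (t • a) y) h1 (by simp [hγ0])
    rw [h2, Function.comp_apply, one_mul]
  refine ⟨fun a y => γ a y 1, hY, fun y => ?_, fun a y => ?_⟩
  · rw [← zero_smul ℝ (0 : V), key, hγ0]
  · simp_rw [key]
    exact hγ a y

variable {π : BivectorField I M}

omit [I.Boundaryless] [IsManifold I ∞ M] [T2Space M] [CompleteSpace E] in
theorem BivectorField.hamiltonian_const_smul (π : BivectorField I M) {f : M → ℝ} {x : M} (t : ℝ)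
    (hf : MDifferentiableAt I 𝓘(ℝ, ℝ) f x) :
    π.hamiltonian (fun y => t * f y) x = t • π.hamiltonian f x := by
  have : mvfderiv I (fun y => t * f y) x = t • mvfderiv I f x := by
    ext v
    exact mvfderiv_clm_comp_apply (t • ContinuousLinearMap.id ℝ ℝ) hf v
  rw [BivectorField.hamiltonian, this, map_smul]
  rfl

omit [I.Boundaryless] [IsManifold I ∞ M] [T2Space M] [CompleteSpace E] in
/-- Points of an integral curve of a Hamiltonian vector field lie in the same leaf. -/
theorem BivectorField.sameLeaf_of_isMIntegralCurveOn {f : M → ℝ} (hf : ContMDiff I 𝓘(ℝ, ℝ) ∞ f)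
    {γ : ℝ → M} {s : Set ℝ} (hs : s.OrdConnected) (h0 : (0 : ℝ) ∈ s) {t : ℝ} (ht : t ∈ s)
    (hγ : IsMIntegralCurveOn γ (π.hamiltonian f) s) : π.SameLeaf (γ 0) (γ t) := by
  refine .rel _ _ ⟨fun y => t * f y, contMDiff_const.mul hf, γ ∘ (· * t), ?_, by simp, by simp⟩
  have h1 := hγ.comp_mul t
  rw [show π.hamiltonian (fun y => t * f y) = t • π.hamiltonian f from
    funext fun y => π.hamiltonian_const_smul t (hf.mdifferentiableAt (by simp))]
  refine h1.mono fun r hr => ?_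
  have := hs.convex h0 ht (sub_nonneg.2 hr.2) hr.1 (sub_add_cancel _ _)
  simpa using this

omit [T2Space M] in
/-- A function which is constant along the leaves is a Casimir function. -/
theorem BivectorField.IsPoisson.bracket_eq_zero_of_sameLeaf (hπ : π.IsPoisson) {f g : M → ℝ}
    (hf : ContMDiff I 𝓘(ℝ, ℝ) ∞ f) (hleaf : ∀ x y, π.SameLeaf x y → f x = f y)
    (hg : ContMDiff I 𝓘(ℝ, ℝ) ∞ g) (x : M) : π.bracket f g x = 0 := by
  obtain ⟨γ, rfl, hγ⟩ := exists_isMIntegralCurveAt_of_contMDiffAt_boundaryless (t₀ := 0)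
    (((hπ.smooth g hg).contMDiffAt (x := x)).of_le (by simp))
  obtain ⟨ε, hε, hγε⟩ := isMIntegralCurveAt_iff'.1 hγ
  have h1 : (fun t => f (γ t)) =ᶠ[𝓝 0] fun _ => f (γ 0) := by
    filter_upwards [Metric.ball_mem_nhds 0 hε] with t ht
    exact (hleaf _ _ (sameLeaf_of_isMIntegralCurveOn hg (convex_ball (0 : ℝ) ε).ordConnected
      (Metric.mem_ball_self hε) ht hγε)).symm
  have h2 := (hγ.self_of_nhds).hasDerivAt_comp_curve (hf.mdifferentiableAt (by simp))
  exact h2.unique ((hasDerivAt_const _ _).congr_of_eventuallyEq h1)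

/-- By skew-symmetry, the Hamiltonian vector field of a Casimir function vanishes. -/
theorem BivectorField.IsPoisson.hamiltonian_eq_zero_of_sameLeaf [FiniteDimensional ℝ E]
    (hπ : π.IsPoisson) {f : M → ℝ} (hf : ContMDiff I 𝓘(ℝ, ℝ) ∞ f)
    (hleaf : ∀ x y, π.SameLeaf x y → f x = f y) (x : M) : π.hamiltonian f x = 0 := by
  refine tangent_eq_of_forall_mvfderiv fun g hg => ?_
  rw [map_zero]
  refine (bracket_skew g f x).trans ?_
  rw [hπ.bracket_eq_zero_of_sameLeaf hf hleaf hg, neg_zero]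

end Complete

/-! ### The canonical family of a framing -/

section Framing

variable {E : Type} [NormedAddCommGroup E] [NormedSpace ℝ E]
  {H : Type*} [TopologicalSpace H] {I : ModelWithCorners ℝ E H}
  {M : Type*} [TopologicalSpace M] [ChartedSpace H M]
  {π : BivectorField I M} {𝔤 : Type*} [LieRing 𝔤] [LieAlgebra ℝ 𝔤]

theorem mvfderiv_fun_sum {κ : Type*} {s : Finset κ} {f : κ → M → ℝ} {x : M}
    (hf : ∀ i, ContMDiff I 𝓘(ℝ, ℝ) ∞ (f i)) :
    mvfderiv I (fun y => ∑ i ∈ s, f i y) x = ∑ i ∈ s, mvfderiv I (f i) x := by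
  classical
  induction s using Finset.induction_on with
  | empty => simpa using mvfderiv_const (I := I) (0 : ℝ)
  | insert i s hi ih =>
    simp only [Finset.sum_insert hi]
    rw [mvfderiv_fun_add ((hf i).mdifferentiableAt (by simp))
      ((contMDiff_finsetSum fun j _ => hf j).mdifferentiableAt (by simp)), ih]

/-- The fundamental vector fields at a point, as a linear map on the Lie algebra. -/
noncomputable def WeaklyHamiltonianAction.fieldAt (ρ : WeaklyHamiltonianAction π 𝔤) (x : M) :
    𝔤 →ₗ[ℝ] TangentSpace I x where
  toFun u := ρ.field u x
  map_add' u v := by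
    have : mvfderiv I (ρ.ham (u + v)) x = mvfderiv I (ρ.ham u) x + mvfderiv I (ρ.ham v) x := by
      rw [map_add, ContMDiffMap.coe_add]
      exact mvfderiv_add ((ρ.ham u).contMDiff.mdifferentiableAt (by simp))
        ((ρ.ham v).contMDiff.mdifferentiableAt (by simp))
    rw [field, BivectorField.hamiltonian, this, map_add]
    rfl
  map_smul' t u := by
    rw [field, map_smul]
    exact π.hamiltonian_const_smul t ((ρ.ham u).contMDiff.mdifferentiableAt (by simp))

namespace LeafSubbundle.Framing

variable {F : LeafSubbundle π 𝔤} {l : ℕ} (b : F.Framing l) (ρ : WeaklyHamiltonianAction π 𝔤)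

/-- The sections `x ↦ 𝔟ₓ⁻¹(a)` of `F`, as elements of the Lie algebra. -/
noncomputable def frame (x : M) : EuclideanSpace ℝ (Fin l) →ₗ[ℝ] 𝔤 :=
  (F.fiber x).subtype ∘ₗ (b.triv x).symm.toLinearMap

theorem frame_eq_of_sameLeaf {x y : M} (h : π.SameLeaf x y) (a : EuclideanSpace ℝ (Fin l)) :
    b.frame x a = b.frame y a := by
  have hx : b.frame x a ∈ F.fiber x := ((b.triv x).symm a).2
  have hy : b.frame x a ∈ F.fiber y := F.fiber_eq x y h ▸ hx
  have h1 : a = b.triv y ⟨b.frame x a, hy⟩ := by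
    rw [← b.triv_eq x y h _ hx hy]
    exact ((b.triv x).apply_symm_apply a).symm
  have h2 := congrArg (fun v => ((b.triv y).symm v : 𝔤)) h1
  rw [(b.triv y).symm_apply_apply] at h2
  exact h2.symm

/-- The functions `μ_a(x) = H_u(x)` with `u = 𝔟ₓ⁻¹(a)`. -/
noncomputable def hamFamily : EuclideanSpace ℝ (Fin l) →ₗ[ℝ] (M → ℝ) where
  toFun a x := ρ.ham (b.frame x a) x
  map_add' a c := by
    funext x
    rw [map_add, map_add]
    rfl
  map_smul' t a := by
    funext x
    rw [map_smul, map_smul]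
    rfl

/-- The vector fields `Y_a(x) = X_u(x)` with `u = 𝔟ₓ⁻¹(a)`. -/
noncomputable def fieldFamily : EuclideanSpace ℝ (Fin l) →ₗ[ℝ] ((x : M) → TangentSpace I x) where
  toFun a x := ρ.fieldAt x (b.frame x a)
  map_add' a c := by
    funext x
    rw [map_add, map_add]
    rfl
  map_smul' t a := by
    funext x
    rw [map_smul, map_smul]
    rfl

theorem fieldFamily_apply (a : EuclideanSpace ℝ (Fin l)) (x : M) :
    b.fieldFamily ρ a x = ρ.field (b.frame x a) x :=
  rfl

/-- The frame is constant along an integral curve of `X_u`, `u = 𝔟ₓ⁻¹(a)`, so that this curve is one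
of `Y_a`. -/
theorem exists_isMIntegralCurve_fieldFamily (hρ : ρ.IsComplete)
    (a : EuclideanSpace ℝ (Fin l)) (x : M) :
    ∃ γ : ℝ → M, γ 0 = x ∧ IsMIntegralCurve γ (b.fieldFamily ρ a) := by
  obtain ⟨γ, h0, hγ⟩ := hρ (b.frame x a) x
  refine ⟨γ, h0, fun t => ?_⟩
  have h : π.SameLeaf x (γ t) := h0 ▸
    BivectorField.sameLeaf_of_isMIntegralCurveOn (ρ.ham (b.frame x a)).contMDiff ordConnected_univ
      (mem_univ _) (mem_univ t) (hγ.isMIntegralCurveOn _)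
  rw [b.fieldFamily_apply, ← b.frame_eq_of_sameLeaf h]
  exact hγ t

theorem zeroLocus_eq (Ω : LinearSymplecticForm (EuclideanSpace ℝ (Fin l))) :
    F.zeroLocus ρ = {x | momentMap Ω (b.hamFamily ρ) x = 0} := by
  ext x
  constructor
  · intro hx
    refine Ω.ext_left fun c => ?_
    rw [form_momentMap, map_zero, LinearMap.zero_apply]
    exact hx _ ((b.triv x).symm c).2
  · intro (hx : momentMap Ω (b.hamFamily ρ) x = 0) u hu
    have h := form_momentMap Ω (b.hamFamily ρ) x (b.triv x ⟨u, hu⟩)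
    rw [hx, map_zero, LinearMap.zero_apply] at h
    have h1 : b.frame x (b.triv x ⟨u, hu⟩) = u :=
      congrArg Subtype.val ((b.triv x).symm_apply_apply ⟨u, hu⟩)
    have h2 : ρ.ham (b.frame x (b.triv x ⟨u, hu⟩)) x = 0 := h.symm
    rwa [h1] at h2

variable [FiniteDimensional ℝ 𝔤]

theorem hamFamily_eq_sum (a : EuclideanSpace ℝ (Fin l)) : b.hamFamily ρ a = fun x =>
    ∑ i, (Module.finBasis ℝ 𝔤).coord i (b.frame x a) * ρ.ham (Module.finBasis ℝ 𝔤 i) x := by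
  funext x
  let e := Module.finBasis ℝ 𝔤
  let T : 𝔤 →ₗ[ℝ] ℝ :=
    { toFun := fun u => ρ.ham u x
      map_add' := fun u v => by rw [map_add]; rfl
      map_smul' := fun t u => by rw [map_smul]; rfl }
  have h := congrArg T (e.sum_repr (b.frame x a))
  rw [map_sum] at h
  simp only [map_smul, smul_eq_mul] at h
  exact h.symm

theorem contMDiff_hamFamily (a : EuclideanSpace ℝ (Fin l)) :
    ContMDiff I 𝓘(ℝ, ℝ) ∞ (b.hamFamily ρ a) := by
  rw [hamFamily_eq_sum]
  exact contMDiff_finsetSum fun i _ => (b.smooth a _).mul (ρ.ham _).contMDiff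

variable [FiniteDimensional ℝ E] [I.Boundaryless] [IsManifold I ∞ M] [T2Space M]

/-- Since the coefficients of the frame are Casimir functions, `X_{μ_a}(x) = X_u(x)` with
`u = 𝔟ₓ⁻¹(a)`. -/
theorem hamiltonian_hamFamily (hπ : π.IsPoisson) (a : EuclideanSpace ℝ (Fin l)) (x : M) :
    π.hamiltonian (b.hamFamily ρ a) x = b.fieldFamily ρ a x := by
  let e := Module.finBasis ℝ 𝔤
  have hc : ∀ i, ContMDiff I 𝓘(ℝ, ℝ) ∞ (fun x => e.coord i (b.frame x a)) := fun i => b.smooth a _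
  have hcas : ∀ i, π.sharp x (mvfderiv I (fun x => e.coord i (b.frame x a)) x) = 0 := fun i =>
    haveI := FiniteDimensional.complete ℝ E
    hπ.hamiltonian_eq_zero_of_sameLeaf (hc i)
      (fun y z h => by rw [b.frame_eq_of_sameLeaf h]) x
  have hd : mvfderiv I (b.hamFamily ρ a) x = ∑ i,
      (e.coord i (b.frame x a) • mvfderiv I (ρ.ham (e i)) x +
        ρ.ham (e i) x • mvfderiv I (fun x => e.coord i (b.frame x a)) x) := by
    rw [hamFamily_eq_sum]
    refine (mvfderiv_fun_sum (f := fun i y => e.coord i (b.frame y a) * ρ.ham (e i) y)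
      fun i => (hc i).mul (ρ.ham (e i)).contMDiff).trans ?_
    exact Finset.sum_congr rfl fun i _ => mvfderiv_fun_mul ((hc i).mdifferentiableAt (by simp))
      ((ρ.ham (e i)).contMDiff.mdifferentiableAt (by simp))
  rw [BivectorField.hamiltonian, hd, map_sum]
  simp only [map_add, map_smul, hcas, smul_zero, add_zero]
  have h := congrArg (ρ.fieldAt x) (e.sum_repr (b.frame x a))
  rw [map_sum] at h
  simp only [map_smul] at h
  exact h

/-- For abelian `𝔤` the cocycle is the bracket, so compatibility of the framing with the cocycle
says that the `μ_a` have constant brackets `Ω(a, c)`. -/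
theorem isCanonicalFamily [IsLieAbelian 𝔤] (hπ : π.IsPoisson)
    {Ω : LinearSymplecticForm (EuclideanSpace ℝ (Fin l))}
    (hΩ : ∀ (x : M) (u v : F.fiber x), ρ.cocycle u v x = Ω.form (b.triv x u) (b.triv x v)) :
    IsCanonicalFamily π Ω (b.hamFamily ρ) (b.fieldFamily ρ) where
  smooth := b.contMDiff_hamFamily ρ
  hamiltonian := b.hamiltonian_hamFamily ρ hπ
  bracket a c x := by
    let u := (b.triv x).symm a
    let v := (b.triv x).symm c
    have h1 := hΩ x u v
    rw [(b.triv x).apply_symm_apply, (b.triv x).apply_symm_apply] at h1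
    have h2 : π.bracket (ρ.ham u) (ρ.ham v) x = Ω.form a c := by
      rw [← h1, WeaklyHamiltonianAction.cocycle, trivial_lie_zero, map_zero]
      exact (sub_zero _).symm
    rw [BivectorField.bracket, b.hamiltonian_hamFamily ρ hπ, b.fieldFamily_apply]
    refine (BivectorField.bracket_skew (b.hamFamily ρ a) (ρ.ham v) x).trans ?_
    rw [BivectorField.bracket, b.hamiltonian_hamFamily ρ hπ, b.fieldFamily_apply, ← h2]
    exact (BivectorField.bracket_skew (ρ.ham u) (ρ.ham v) x).symm

/-- Conversely, integral curves of `Y_a` are integral curves of fundamental vector fields. -/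
theorem isMIntegralCurve_field {γ : ℝ → M} {a : EuclideanSpace ℝ (Fin l)}
    (hγ : IsMIntegralCurve γ (b.fieldFamily ρ a)) (hπ : π.IsPoisson) :
    IsMIntegralCurve γ (ρ.field (b.frame (γ 0) a)) := by
  have h : ∀ t, π.SameLeaf (γ 0) (γ t) := fun t =>
    BivectorField.sameLeaf_of_isMIntegralCurveOn (b.contMDiff_hamFamily ρ a) ordConnected_univ
      (mem_univ _) (mem_univ t) (by
        rw [show π.hamiltonian (b.hamFamily ρ a) = b.fieldFamily ρ a from
          funext (b.hamiltonian_hamFamily ρ hπ a)]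
        exact hγ.isMIntegralCurveOn _)
  intro t
  rw [b.frame_eq_of_sameLeaf (h t)]
  exact hγ t

end LeafSubbundle.Framing

end Framing

/-! ### The splitting theorem -/

theorem mainTheorem2 {m d : ℕ}
    {M : Type*} [TopologicalSpace M] [T2Space M] [SecondCountableTopology M] [ConnectedSpace M]
    [ChartedSpace (EuclideanSpace ℝ (Fin m)) M] [IsManifold (𝓡 m) ∞ M]
    (π : BivectorField (𝓡 m) M) (hπ : π.IsPoisson)
    {𝔤 : Type*} [LieRing 𝔤] [LieAlgebra ℝ 𝔤] [FiniteDimensional ℝ 𝔤] [IsLieAbelian 𝔤]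
    (ρ : WeaklyHamiltonianAction π 𝔤) (hρ : ρ.IsComplete)
    (F : LeafSubbundle π 𝔤) (hF : F.IsSymplectic ρ)
    (b : F.Framing (2 * d)) (Ω : LinearSymplecticForm (EuclideanSpace ℝ (Fin (2 * d))))
    (hΩ : ∀ (x : M) (u v : F.fiber x), ρ.cocycle u v x = Ω.form (b.triv x u) (b.triv x v)) :
    ∃ (n : ℕ) (_ : n + 2 * d = m)
      (_ : ChartedSpace (EuclideanSpace ℝ (Fin n)) (F.zeroLocus ρ))
      (_ : IsManifold (𝓡 n) ∞ (F.zeroLocus ρ))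
      (πN : BivectorField (𝓡 n) (F.zeroLocus ρ))
      (Φ : Diffeomorph (𝓡 m) (𝓘(ℝ, EuclideanSpace ℝ (Fin (2 * d))).prod (𝓡 n)) M
        (EuclideanSpace ℝ (Fin (2 * d)) × F.zeroLocus ρ) ∞),
      IsSmoothEmbedding (𝓡 n) (𝓡 m) ∞ (Subtype.val : F.zeroLocus ρ → M) ∧
      πN.IsPoisson ∧
      IsPoissonDirac π (Subtype.val : F.zeroLocus ρ → M) πN ∧
      (∀ y : M, ρ.FlowsTo ((b.triv y).symm (Φ y).1) y (Φ y).2) ∧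
      IsPoissonMap π (Ω.inv.prod πN) Φ := by
  have hμ := b.isCanonicalFamily ρ hπ hΩ
  set μ := b.hamFamily ρ
  set Y := b.fieldFamily ρ
  set J := momentMap Ω μ
  have hYs : ∀ a, ContMDiff (𝓡 m) (𝓡 m).tangent ∞
      (fun x => (⟨x, Y a x⟩ : TangentBundle (𝓡 m) M)) := fun a => by
    simp_rw [← hμ.hamiltonian]
    exact hπ.smooth _ (hμ.smooth a)
  obtain ⟨A, hA⟩ := exists_isTimeOneFlow Y hYs (b.exists_isMIntegralCurve_fieldFamily ρ hρ)
  have hJ : ContMDiff (𝓡 m) 𝓘(ℝ, EuclideanSpace ℝ (Fin (2 * d))) ∞ J := hμ.contMDiff_momentMap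
  have hsurj := hμ.surjective_mvfderiv_momentMap
  obtain ⟨x₀⟩ : Nonempty M := inferInstance
  -- `dJ` is onto, so `2d ≤ m`
  have hdm : 2 * d ≤ m := by
    have := LinearMap.finrank_le_finrank_of_surjective
      (f := (show EuclideanSpace ℝ (Fin m) →L[ℝ] EuclideanSpace ℝ (Fin (2 * d)) from
        mvfderiv (𝓡 m) J x₀).toLinearMap) (hsurj x₀)
    simpa using this
  have hnm : (m - 2 * d) + 2 * d = m := Nat.sub_add_cancel hdm
  let L : (EuclideanSpace ℝ (Fin (m - 2 * d)) × EuclideanSpace ℝ (Fin (2 * d))) ≃L[ℝ]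
      EuclideanSpace ℝ (Fin m) :=
    ContinuousLinearEquiv.ofFinrankEq (by simp [hnm])
  have hzero : F.zeroLocus ρ = {x | J x = 0} := b.zeroLocus_eq ρ Ω
  have hchart : ∀ x : M, ∃ e, IsSliceChart L (F.zeroLocus ρ) e ∧ x ∈ e.source := fun x => by
    rw [hzero]
    exact exists_isSliceChart L hJ (hsurj x)
  choose c hc hx using fun x : F.zeroLocus ρ => hchart x
  let _ := chartedSpaceOfSlice L hc hx
  have : IsManifold (𝓡 (m - 2 * d)) ∞ (F.zeroLocus ρ) := isManifold_ofSlice L hc hx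
  have hJ0 : ∀ x : F.zeroLocus ρ, J x = 0 := fun x => hzero.subset x.2
  let p : M → F.zeroLocus ρ := fun y => ⟨A (J y) y,
    hzero.superset ((hμ.momentMap_flow hA (J y) y).trans (sub_self _))⟩
  have hs : IsZeroSlice (𝓡 m) (𝓡 (m - 2 * d)) Ω μ A (Subtype.val : F.zeroLocus ρ → M) p :=
    ⟨isSmoothEmbedding_ofSlice L hc hx, hJ0, fun _ => rfl⟩
  refine ⟨m - 2 * d, hnm, inferInstance, inferInstance,
    reducedBivector (𝓡 (m - 2 * d)) π Subtype.val p, hs.splitting hA hμ hπ,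
    hs.isSmoothEmbedding, hs.isPoisson_reducedBivector hA hμ hπ, hs.isPoissonDirac hA hμ hπ,
    fun y => ?_, hs.isPoissonMap_splitting hA hμ hπ⟩
  have h1 := b.isMIntegralCurve_field ρ (hA.curve (J y) y) hπ
  rw [zero_smul, hA.zero] at h1
  refine ⟨_, h1, ?_, ?_⟩
  · rw [zero_smul, hA.zero]
  · rw [one_smul]
    rfl
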